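/- Let $\mu\in\mathbb R$ with $\mu>-\tfrac12$. Let $\Phi(a,c,z)=\sum_{k\ge 0}\frac{(a)_k}{(c)_k}\frac{z^k}{k!}$ be the confluent hypergeometric function, so that $\Phi(-m,c,x)=\sum_{k=0}^m(-1)^k\binom mk\frac{\Gamma(c)}{\Gamma(k+c)}x^k$ for $m\in\mathbb N=\{0,1,2,\dots\}$ and $c>0$. For $m\in\mathbb N$ and $x\in\mathbb R$ put $$H^\mu_{2m}(x)=(-1)^m\frac{(2m)!}{m!}\,\Phi(-m,\mu+\tfrac12,x^2),\qquad H^\mu_{2m+1}(x)=(-1)^m\frac{(2m+1)!}{m!}\,\frac{x}{\mu+\frac12}\,\Phi(-m,\mu+\tfrac32,x^2),$$ $$\gamma_\mu(2m)=\frac{2^{2m}\,m!\,\Gamma(m+\mu+\frac12)}{\Gamma(\mu+\frac12)},\qquad \gamma_\mu(2m+1)=\frac{2^{2m+1}\,m!\,\Gamma(m+\mu+\frac32)}{\Gamma(\mu+\frac12)},$$ and define $\mathbf e_\mu(z)=e^z\,\Phi(\mu,2\mu+1,-2z)$ for $z\in\mathbb C$ and the generalized Hermite functions $$\phi^\mu_n(x)=\Bigl(\frac{\gamma_\mu(n)}{\Gamma(\mu+\frac12)}\Bigr)^{1/2}\frac{1}{2^{n/2}\,n!}\,e^{-x^2/2}H^\mu_n(x),\qquad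 n\in\mathbb N,\ x\in\mathbb R .$$ Let $L^2_\mu(\mathbb R)=L^2(\mathbb R,|t|^{2\mu}dt)$ (complex-valued functions), and for $f$ in the complex linear span $\mathfrak S$ of the functions $x\mapsto x^n e^{-x^2/2}$, $n\in\mathbb N$, let $$\mathcal F_\mu f(x)=\bigl(2^{\mu+\frac12}\,\Gamma(\mu+\tfrac12)\bigr)^{-1}\int_{-\infty}^\infty \mathbf e_\mu(-ixt)\,f(t)\,|t|^{2\mu}\,dt,\qquad x\in\mathbb R .$$ Then: 1. $\{\phi^\mu_n\}_{n\in\mathbb N}$ is a complete orthonormal set in $L^2_\mu(\mathbb R)$, that is, an orthonormal family whose linear span is dense. 2. For every $n\in\mathbb N$, $\phi^\mu_n\in\mathfrak S$, the integral defining $\mathcal F_\mu\phi^\mu_n(x)$ converges absolutely for every $x\in\mathbb R$, and $\mathcal F_\mu\phi^\mu_n=(-i)^n\phi^\mu_n$. 3. (Mehler formula) For all $x,y\in\mathbb R$ and $z\in\mathbb C$ with $|z|<1$, with absolute convergence of the series, $$\sum_{n=0}^\infty\phi^\mu_n(x)\,\phi^\mu_n(y)\,z^n=\frac{1}{\Gamma(\mu+\frac12)}\,\frac{1}{(1-z^2)^{\mu+\frac12}}\exp\Bigl(-\tfrac12(x^2+y^2)\frac{1+z^2}{1-z^2}\Bigr)\,\mathbf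 e_\mu\Bigl(2xy\,\frac{z}{1-z^2}\Bigr),$$ where the power of $1-z^2$ is the principal branch. -/

import Mathlib

open MeasureTheory

noncomputable section

namespace GenHermite

/-- The confluent hypergeometric (Kummer) function
`Φ(a, c, z) = ∑_{k ≥ 0} (a)_k / (c)_k * z ^ k / k!`, where `(a)_k = a (a + 1) ⋯ (a + k - 1)`. -/
def confluent (a c z : ℂ) : ℂ :=
  ∑' k : ℕ, (ascPochhammer ℂ k).eval a / (ascPochhammer ℂ k).eval c * (z ^ k / (k.factorial : ℂ))

/-- The `m`-th confluent hypergeometric polynomial `Φ(-m, c, x)`, written as the finite sum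
`∑_{k = 0}^m (-1) ^ k * binom(m, k) * Γ(c) / Γ(k + c) * x ^ k`. -/
def confluentPoly (m : ℕ) (c x : ℝ) : ℝ :=
  ∑ k ∈ Finset.range (m + 1),
    (-1 : ℝ) ^ k * (m.choose k : ℝ) * (Real.Gamma c / Real.Gamma ((k : ℝ) + c)) * x ^ k

/-- The generalized Hermite polynomial `H_n^μ`:
`H_{2m}^μ(x) = (-1)^m (2m)!/m! * Φ(-m, μ + 1/2, x²)` and
`H_{2m+1}^μ(x) = (-1)^m (2m+1)!/m! * x / (μ + 1/2) * Φ(-m, μ + 3/2, x²)`. -/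
def hermiteH (μ : ℝ) (n : ℕ) (x : ℝ) : ℝ :=
  if Even n then
    (-1 : ℝ) ^ (n / 2) * ((n.factorial : ℝ) / ((n / 2).factorial : ℝ)) *
      confluentPoly (n / 2) (μ + 1 / 2) (x ^ 2)
  else
    (-1 : ℝ) ^ (n / 2) * ((n.factorial : ℝ) / ((n / 2).factorial : ℝ)) * (x / (μ + 1 / 2)) *
      confluentPoly (n / 2) (μ + 3 / 2) (x ^ 2)

/-- The generalized exponential function `e_μ(z) = e^z Φ(μ, 2μ + 1, -2z)`. -/
def expMu (μ : ℝ) (z : ℂ) : ℂ :=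
  Complex.exp z * confluent (μ : ℂ) (2 * (μ : ℂ) + 1) (-2 * z)

/-- The generalized factorial `γ_μ`:
`γ_μ(2m) = 2^(2m) m! Γ(m + μ + 1/2) / Γ(μ + 1/2)` and
`γ_μ(2m+1) = 2^(2m+1) m! Γ(m + μ + 3/2) / Γ(μ + 1/2)`. -/
def gammaMu (μ : ℝ) (n : ℕ) : ℝ :=
  if Even n then
    2 ^ n * ((n / 2).factorial : ℝ) * Real.Gamma (((n / 2 : ℕ) : ℝ) + μ + 1 / 2) /
      Real.Gamma (μ + 1 / 2)
  else
    2 ^ n * ((n / 2).factorial : ℝ) * Real.Gamma (((n / 2 : ℕ) : ℝ) + μ + 3 / 2) /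
      Real.Gamma (μ + 1 / 2)

/-- The generalized Hermite function
`φ_n^μ(x) = (γ_μ(n) / Γ(μ + 1/2))^(1/2) * 1 / (2^(n/2) n!) * exp(-x²/2) * H_n^μ(x)`. -/
def hermiteFun (μ : ℝ) (n : ℕ) (x : ℝ) : ℝ :=
  (gammaMu μ n / Real.Gamma (μ + 1 / 2)) ^ (1 / 2 : ℝ) *
    (1 / ((2 : ℝ) ^ ((n : ℝ) / 2) * (n.factorial : ℝ))) *
    Real.exp (-(1 / 2) * x ^ 2) * hermiteH μ n x

/-- The measure `|t|^(2μ) dt` on `ℝ`; `L²_μ(ℝ)` is `Lp ℂ 2 (weightMeasure μ)`. -/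
def weightMeasure (μ : ℝ) : Measure ℝ :=
  volume.withDensity fun t => ENNReal.ofReal (|t| ^ (2 * μ))

/-- The integrand `e_μ(-ixt) f(t) |t|^(2μ)` of the generalized Fourier transform. -/
def fourierIntegrand (μ : ℝ) (f : ℝ → ℂ) (x t : ℝ) : ℂ :=
  expMu μ (-Complex.I * (x : ℂ) * (t : ℂ)) * f t * ((|t| ^ (2 * μ) : ℝ) : ℂ)

/-- The generalized Fourier transform
`𝓕_μ f(x) = (2^(μ + 1/2) Γ(μ + 1/2))⁻¹ ∫ e_μ(-ixt) f(t) |t|^(2μ) dt`. -/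
def fourierMu (μ : ℝ) (f : ℝ → ℂ) (x : ℝ) : ℂ :=
  (((2 : ℝ) ^ (μ + 1 / 2) * Real.Gamma (μ + 1 / 2) : ℝ) : ℂ)⁻¹ *
    ∫ t : ℝ, fourierIntegrand μ f x t

/-- The domain of the generalized Fourier transform: the complex linear span of the functions
`x ↦ exp(-x²/2) x^n`, `n ∈ ℕ`. -/
def fourierDomain : Submodule ℂ (ℝ → ℂ) :=
  Submodule.span ℂ
    (Set.range fun (n : ℕ) (x : ℝ) => ((Real.exp (-(1 / 2) * x ^ 2) * x ^ n : ℝ) : ℂ))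

end GenHermite

end

noncomputable section

/-! Put `c = μ + 1/2`. In even degree the generalized Hermite function is a normalized Laguerre
function `exp(-x²/2) Φ(-m, c, x²)`; in odd degree it is `x` times the one with parameter `c + 1`.
Since `|t|^(2μ) = |t|^(2c - 1)`, a factor `t²` absorbed into the weight also replaces `c` by `c +
1`. Thus orthonormality, the eigenvalue equation and the Mehler formula split by parity into
statements about Laguerre functions with one positive parameter. The kernel splits in the same way:
by Kummer's second formula `e_μ(z) = ∑ zⁿ / γ_μ(n)`, whose even and odd halves are Bessel series
with parameters `c` and `c + 1` (`expMu_eq`).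

Orthogonality: the Gaussian moments are `Γ(c + q)`, and integrating `Φ(-m, c, t²)` against `t^(2q)`
becomes an `m`-th finite difference of a polynomial of degree `q`, zero for `q < m`.

Eigenfunctions: integrating the Bessel series term by term and applying Kummer's first
transformation sends `t^(2i)` times the Gaussian to the Gaussian times `Φ(-i, c, x²/2)`; a binomial
transform with ratio `-2` reassembles `±Φ(-m, c, x²)`.

Mehler formula: this is the Hille–Hardy formula at `w = z²`. Products `C(m, i) C(m, j)` are
linearized so that the sum over `m` is a binomial series, and the remaining triple sum factors into
a Bessel series and two exponentials.

Completeness: if `f` is orthogonal to every Hermite function, all moments of `exp(-t²/2) f` vanish.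
Exponential decay makes its Fourier transform the sum of its moment series, hence zero, and Fourier
uniqueness gives `f = 0`. -/

namespace GenHermite

/-! ### Rising factorials and binomial transforms of confluent polynomials. -/

/-- The rising factorial `(c)_k = c (c + 1) ⋯ (c + k - 1)`. -/
def poch (c : ℝ) (k : ℕ) : ℝ := (ascPochhammer ℝ k).eval c

@[simp] lemma poch_zero (c : ℝ) : poch c 0 = 1 := by simp [poch]

lemma poch_succ (c : ℝ) (k : ℕ) : poch c (k + 1) = poch c k * (c + k) := by
  simp [poch, ascPochhammer_succ_right]

lemma poch_pos {c : ℝ} (hc : 0 < c) (k : ℕ) : 0 < poch c k :=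
  ascPochhammer_pos k c hc

lemma poch_ne_zero {c : ℝ} (hc : 0 < c) (k : ℕ) : poch c k ≠ 0 := (poch_pos hc k).ne'

lemma poch_add (c : ℝ) (i q : ℕ) : poch c (i + q) = poch c i * poch (c + i) q := by
  induction q with
  | zero => simp
  | succ q ih => rw [← add_assoc, poch_succ, ih, poch_succ]; push_cast; ring

lemma poch_succ_left (c : ℝ) (q : ℕ) : poch c (q + 1) = c * poch (c + 1) q := by
  rw [add_comm q 1, poch_add, poch_succ]; simp

lemma Gamma_add_natCast {c : ℝ} (hc : 0 < c) (k : ℕ) :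
    Real.Gamma (c + k) = poch c k * Real.Gamma c := by
  induction k with
  | zero => simp
  | succ k ih =>
    rw [Nat.cast_succ, ← add_assoc, Real.Gamma_add_one (by positivity), ih, poch_succ]; ring

lemma ofReal_poch (c : ℝ) (k : ℕ) : ((poch c k : ℝ) : ℂ) = (ascPochhammer ℂ k).eval (c : ℂ) := by
  induction k with
  | zero => simp
  | succ k ih => rw [poch_succ, ascPochhammer_succ_eval, ← ih]; push_cast; ring

lemma confluentPoly_eq_sum (m : ℕ) {c : ℝ} (hc : 0 < c) (x : ℝ) :
    confluentPoly m c x =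
      ∑ k ∈ Finset.range (m + 1), (m.choose k : ℝ) * ((-x) ^ k / poch c k) := by
  refine Finset.sum_congr rfl fun k _ => ?_
  have := (Real.Gamma_pos_of_pos hc).ne'
  have := poch_ne_zero hc k
  rw [add_comm (k : ℝ) c, Gamma_add_natCast hc, neg_pow x]
  field_simp

/-- The sum may be extended to any longer range. -/
lemma confluentPoly_eq_sum_of_le {m N : ℕ} (h : m ≤ N) {c : ℝ} (hc : 0 < c) (x : ℝ) :
    confluentPoly m c x =
      ∑ k ∈ Finset.range (N + 1), (m.choose k : ℝ) * ((-x) ^ k / poch c k) := by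
  rw [confluentPoly_eq_sum m hc]
  refine Finset.sum_subset (by intro; simp; omega) fun k _ hk => ?_
  rw [Nat.choose_eq_zero_of_lt (by simpa using hk)]; simp

/-- This is `r^l / l!` times the `l`-th derivative of `(1 + r)^m`. It is used at `r = -1`, where
only `l = m` survives, and at `r = -2`, where `1 + r` is a sign. -/
lemma sum_choose_mul_choose_mul_pow (m l : ℕ) (r : ℝ) :
    ∑ i ∈ Finset.range (m + 1), (m.choose i : ℝ) * r ^ i * (i.choose l : ℝ) =
      (m.choose l : ℝ) * r ^ l * (1 + r) ^ (m - l) := by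
  rcases lt_or_ge m l with h | h
  · rw [Nat.choose_eq_zero_of_lt h, Finset.sum_eq_zero]
    · simp
    · intro i hi
      rw [Nat.choose_eq_zero_of_lt (n := i) (by simp at hi; omega)]; simp
  · obtain ⟨d, rfl⟩ := Nat.exists_eq_add_of_le h
    have : ∑ i ∈ Finset.range l, ((l + d).choose i : ℝ) * r ^ i * (i.choose l : ℝ) = 0 :=
      Finset.sum_eq_zero fun i hi => by
        rw [Nat.choose_eq_zero_of_lt (n := i) (by simpa using hi)]; simp
    rw [add_assoc, Finset.sum_range_add, this, zero_add, add_comm 1 r, add_pow,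
      Nat.add_sub_cancel_left, Finset.mul_sum]
    refine Finset.sum_congr rfl fun j hj => ?_
    have h1 : (l + d).choose (l + j) * (l + j).choose l = (l + d).choose l * d.choose j := by
      have := Nat.choose_mul (n := l + d) (k := l + j) (s := l) (by omega)
      simpa using this
    have h2 : ((l + d).choose (l + j) : ℝ) * ((l + j).choose l : ℝ) =
        ((l + d).choose l : ℝ) * (d.choose j : ℝ) := by exact_mod_cast h1
    rw [pow_add, one_pow]
    linear_combination r ^ l * r ^ j * h2

/-- Chu–Vandermonde. -/
lemma poch_add_div_poch {c : ℝ} (hc : 0 < c) (i q : ℕ) :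
    poch (c + i) q = poch c q * ∑ l ∈ Finset.range (q + 1),
      (q.choose l : ℝ) * ((i.choose l : ℝ) * ((l.factorial : ℝ) / poch c l)) := by
  induction q with
  | zero => simp
  | succ q ih =>
    rw [poch_succ, ih, poch_succ, mul_assoc, mul_assoc]
    congr 1
    rw [Finset.sum_mul, Finset.sum_range_succ' _ (q + 1), mul_add (c + (q : ℝ)), Finset.mul_sum]
    -- Write `c + i + q = (c + q + l) + (i - l)`; the factor `i - l` turns `C(i, l)` into `(l + 1)
    -- C(i, l + 1)`. Regrouping by the lower index of `C(i, ·)` then gives Pascal's rule in `q`.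
    have key : ∀ l : ℕ, ((q.choose l : ℝ) * ((i.choose l : ℝ) * ((l.factorial : ℝ) / poch c l)))
          * (c + i + q) =
        (q.choose l : ℝ) * (c + q + l) * ((i.choose l : ℝ) * ((l.factorial : ℝ) / poch c l)) +
        (q.choose l : ℝ) * (c + l) *
          ((i.choose (l + 1) : ℝ) * (((l + 1).factorial : ℝ) / poch c (l + 1))) := by
      intro l
      have h1 : (i.choose (l + 1) : ℝ) * (l + 1) = (i.choose l : ℝ) * (i - l) := by
        rcases le_or_gt l i with h | h
        · have := Nat.choose_succ_right_eq i l
          rw [← Nat.cast_sub h]; exact_mod_cast this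
        · rw [Nat.choose_eq_zero_of_lt h, Nat.choose_eq_zero_of_lt (by omega)]; simp
      have h2 := poch_ne_zero hc l
      have h3 : c + l ≠ 0 := by positivity
      rw [poch_succ, Nat.factorial_succ]
      push_cast
      field_simp
      linear_combination -(q.choose l : ℝ) * h1
    simp_rw [key]
    rw [Finset.sum_add_distrib, Finset.sum_range_succ' _ q]
    have h0 : ∑ k ∈ Finset.range q, ((q.choose (k + 1) : ℝ)) * (c + q + (k + 1 : ℕ)) *
        ((i.choose (k + 1) : ℝ) * (((k + 1).factorial : ℝ) / poch c (k + 1))) =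
        ∑ k ∈ Finset.range (q + 1), ((q.choose (k + 1) : ℝ)) * (c + q + (k + 1 : ℕ)) *
        ((i.choose (k + 1) : ℝ) * (((k + 1).factorial : ℝ) / poch c (k + 1))) := by
      rw [Finset.sum_range_succ, Nat.choose_eq_zero_of_lt (Nat.lt_succ_self q)]; simp
    rw [h0, add_right_comm, ← Finset.sum_add_distrib]
    congr 1
    · refine Finset.sum_congr rfl fun k _ => ?_
      have h1 : (q.choose (k + 1) : ℝ) * (k + 1) = (q.choose k : ℝ) * (q - k) := by
        rcases le_or_gt k q with h | h
        · have := Nat.choose_succ_right_eq q k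
          rw [← Nat.cast_sub h]; exact_mod_cast this
        · rw [Nat.choose_eq_zero_of_lt h, Nat.choose_eq_zero_of_lt (by omega)]; simp
      rw [Nat.choose_succ_succ' q k]
      push_cast
      linear_combination ((i.choose (k + 1) : ℝ) * (((k + 1).factorial : ℝ) / poch c (k + 1))) * h1
    · simp

/-- Binomial transforms of the confluent polynomials. -/
lemma sum_choose_mul_pow_mul_confluentPoly {c : ℝ} (hc : 0 < c) (m : ℕ) (r x : ℝ) :
    ∑ i ∈ Finset.range (m + 1), (m.choose i : ℝ) * r ^ i * confluentPoly i c x =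
      ∑ l ∈ Finset.range (m + 1),
        (m.choose l : ℝ) * r ^ l * (1 + r) ^ (m - l) * ((-x) ^ l / poch c l) := by
  rw [Finset.sum_congr rfl fun i hi => by
    rw [confluentPoly_eq_sum_of_le (N := m) (by simp at hi; omega) hc, Finset.mul_sum]]
  rw [Finset.sum_comm]
  refine Finset.sum_congr rfl fun l _ => ?_
  rw [← sum_choose_mul_choose_mul_pow, Finset.sum_mul]
  exact Finset.sum_congr rfl fun i _ => by ring

/-! ### Bessel series and Kummer's second formula. -/

lemma pow_le_poch {c : ℝ} (hc : 0 < c) (k : ℕ) : c ^ k ≤ poch c k := by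
  induction k with
  | zero => simp
  | succ k ih =>
    rw [pow_succ, poch_succ]
    have : (0 : ℝ) ≤ k := k.cast_nonneg
    exact mul_le_mul ih (by linarith) hc.le (poch_pos hc k).le

/-- The series `∑ s ^ k / (k! (c)_k)`, a normalized Bessel function. -/
def besselSeries (c : ℝ) (s : ℂ) : ℂ := ∑' k : ℕ, s ^ k / ((k.factorial : ℂ) * (poch c k : ℂ))

lemma norm_besselSeries_term {c : ℝ} (hc : 0 < c) (s : ℂ) (k : ℕ) :
    ‖s ^ k / ((k.factorial : ℂ) * (poch c k : ℂ))‖ = ‖s‖ ^ k / (k.factorial * poch c k) := by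
  rw [norm_div, norm_mul, norm_pow, Complex.norm_real, Complex.norm_natCast,
    Real.norm_of_nonneg (poch_pos hc k).le]

lemma summable_besselSeries_real {c : ℝ} (hc : 0 < c) (s : ℝ) :
    Summable fun k : ℕ => s ^ k / (k.factorial * poch c k) := by
  refine Summable.of_norm_bounded (Real.summable_pow_div_factorial (|s| / c)) fun k => ?_
  rw [norm_div, norm_mul, norm_pow, Real.norm_natCast, Real.norm_of_nonneg (poch_pos hc k).le,
    div_pow, div_div, mul_comm (c ^ k), Real.norm_eq_abs]
  have := pow_le_poch hc k
  gcongr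

lemma summable_norm_besselSeries {c : ℝ} (hc : 0 < c) (s : ℂ) :
    Summable fun k : ℕ => ‖s ^ k / ((k.factorial : ℂ) * (poch c k : ℂ))‖ := by
  simp_rw [norm_besselSeries_term hc]
  exact summable_besselSeries_real hc _

lemma hasSum_besselSeries {c : ℝ} (hc : 0 < c) (s : ℂ) :
    HasSum (fun k : ℕ => s ^ k / ((k.factorial : ℂ) * (poch c k : ℂ))) (besselSeries c s) :=
  (summable_norm_besselSeries hc s).of_norm.hasSum

lemma gammaMu_two_mul {μ : ℝ} (hμ : -(1 / 2) < μ) (m : ℕ) :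
    gammaMu μ (2 * m) = 4 ^ m * m.factorial * poch (μ + 1 / 2) m := by
  have hc : 0 < μ + 1 / 2 := by linarith
  have := (Real.Gamma_pos_of_pos hc).ne'
  rw [gammaMu, if_pos (even_two_mul m), Nat.mul_div_cancel_left m two_pos,
    show (m : ℝ) + μ + 1 / 2 = (μ + 1 / 2) + m by ring, Gamma_add_natCast hc, pow_mul]
  generalize Real.Gamma (μ + 1 / 2) = G at *
  generalize poch (μ + 1 / 2) m = P
  field_simp
  norm_num [mul_comm]

lemma gammaMu_two_mul_add_one {μ : ℝ} (hμ : -(1 / 2) < μ) (m : ℕ) :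
    gammaMu μ (2 * m + 1) =
      2 * 4 ^ m * m.factorial * ((μ + 1 / 2) * poch (μ + 3 / 2) m) := by
  have hc : 0 < μ + 1 / 2 := by linarith
  have hG := (Real.Gamma_pos_of_pos hc).ne'
  have hs := Real.Gamma_add_one hc.ne'
  rw [show μ + 1 / 2 + 1 = μ + 3 / 2 by ring] at hs
  rw [gammaMu, if_neg (by simp), show (2 * m + 1) / 2 = m by omega,
    show (m : ℝ) + μ + 3 / 2 = (μ + 3 / 2) + m by ring, Gamma_add_natCast (by linarith), hs,
    pow_succ, pow_mul]
  clear hs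
  generalize Real.Gamma (μ + 1 / 2) = G at *
  generalize poch (μ + 3 / 2) m = P
  field_simp
  norm_num
  ring

/-- Coefficient form of the equation `z E'' + (2μ + 1) E' = (z + 1) E` for `E = ∑ zⁿ / γ_μ(n)`. -/
lemma inv_gammaMu_recurrence {μ : ℝ} (hμ : -(1 / 2) < μ) (n : ℕ) :
    ((n : ℝ) + 2) * (n + 2 * μ + 2) * (gammaMu μ (n + 2))⁻¹ =
      (gammaMu μ (n + 1))⁻¹ + (gammaMu μ n)⁻¹ := by
  have hc : 0 < μ + 1 / 2 := by linarith
  have hc' : 0 < μ + 3 / 2 := by linarith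
  obtain ⟨m, rfl | rfl⟩ := n.even_or_odd'
  · have h1 := poch_succ_left (μ + 1 / 2) m
    rw [show μ + 1 / 2 + 1 = μ + 3 / 2 by ring, poch_succ] at h1
    rw [show 2 * m + 2 = 2 * (m + 1) by ring, gammaMu_two_mul hμ, gammaMu_two_mul hμ,
      gammaMu_two_mul_add_one hμ, ← h1, poch_succ, Nat.factorial_succ]
    have hP := (poch_pos hc m).ne'
    have h2 : (2 * μ + 1 + 2 * m) ≠ 0 := by
      have : (0 : ℝ) ≤ m := m.cast_nonneg
      linarith
    clear h1
    generalize poch (μ + 1 / 2) m = P at *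
    rw [show μ + 1 / 2 + (m : ℝ) = (2 * μ + 1 + 2 * m) / 2 by ring]
    push_cast
    field_simp
    ring
  · have h1 := poch_succ_left (μ + 1 / 2) m
    rw [show μ + 1 / 2 + 1 = μ + 3 / 2 by ring] at h1
    rw [show 2 * m + 1 + 2 = 2 * (m + 1) + 1 by ring, show 2 * m + 1 + 1 = 2 * (m + 1) by ring,
      gammaMu_two_mul hμ, gammaMu_two_mul_add_one hμ, gammaMu_two_mul_add_one hμ, h1, poch_succ,
      Nat.factorial_succ]
    have hP := (poch_pos hc' m).ne'
    have h2 : (2 * μ + 3 + 2 * m) ≠ 0 := by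
      have : (0 : ℝ) ≤ m := m.cast_nonneg
      linarith
    have h3 : 2 * μ + 1 ≠ 0 := by linarith
    clear h1
    generalize poch (μ + 3 / 2) m = P at *
    rw [show μ + 3 / 2 + (m : ℝ) = (2 * μ + 3 + 2 * m) / 2 by ring,
      show μ + 1 / 2 = (2 * μ + 1) / 2 by ring]
    push_cast
    field_simp
    ring

open PowerSeries in
/-- The coefficients of `e^{-z} ∑ zⁿ / γ_μ(n)` are those of `Φ(μ, 2μ + 1, -2z)`. -/
lemma coeff_exp_neg_mul_inv_gammaMu {μ : ℝ} (hμ : -(1 / 2) < μ) (n : ℕ) :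
    ∑ p ∈ Finset.HasAntidiagonal.antidiagonal n,
      (-1 : ℝ) ^ p.1 / (p.1.factorial : ℝ) * (gammaMu μ p.2)⁻¹ =
    poch μ n / poch (2 * μ + 1) n * ((-2) ^ n / n.factorial) := by
  set A : ℝ⟦X⟧ := PowerSeries.mk fun k => (-1 : ℝ) ^ k / (k.factorial : ℝ) with hA
  set E : ℝ⟦X⟧ := PowerSeries.mk fun k => (gammaMu μ k)⁻¹ with hE
  have hcoef : ∀ n, coeff n (A * E) = ∑ p ∈ Finset.HasAntidiagonal.antidiagonal n,
      (-1 : ℝ) ^ p.1 / (p.1.factorial : ℝ) * (gammaMu μ p.2)⁻¹ := fun n => by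
    simp [coeff_mul, hA, hE]
  rw [← hcoef]
  have dA : d⁄dX ℝ A = -A := by
    ext k
    simp only [coeff_derivative, hA, coeff_mk, map_neg, Nat.factorial_succ]
    push_cast
    field_simp
    ring
  obtain ⟨a, ha⟩ : ∃ a, a = 2 * μ + 1 := ⟨_, rfl⟩
  have dE : X * d⁄dX ℝ (d⁄dX ℝ E) + C a * d⁄dX ℝ E = X * E + E := by
    ext k
    rcases k with _ | k
    · have h0 := gammaMu_two_mul hμ 0
      have h1 := gammaMu_two_mul_add_one hμ 0
      norm_num at h0 h1
      simp only [map_add, coeff_zero_X_mul, coeff_C_mul, coeff_derivative, hE, coeff_mk]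
      rw [zero_add, h0, h1, show 2 * (μ + 1 / 2) = a by rw [ha]; ring]
      have : a ≠ 0 := by linarith
      field_simp
      simp
    · have := inv_gammaMu_recurrence hμ k
      simp only [map_add, coeff_succ_X_mul, coeff_C_mul, coeff_derivative, hE, coeff_mk]
      push_cast
      rw [ha]
      linear_combination this
  -- The product `e^{-z} E` satisfies Kummer's equation in the variable `-2z`. Its coefficients
  -- therefore obey a two-term recurrence, which determines them from the constant term.
  have dv : X * d⁄dX ℝ (d⁄dX ℝ (A * E)) + C a * d⁄dX ℝ (A * E) +
      C 2 * (X * d⁄dX ℝ (A * E)) + C (2 * μ) * (A * E) = 0 := by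
    have h2 : (C 2 : ℝ⟦X⟧) = 2 := map_ofNat _ 2
    have h3 : (C a : ℝ⟦X⟧) = C (2 * μ) + 1 := by rw [ha, map_add, map_one]
    rw [h3] at dE
    rw [h2, h3]
    simp only [Derivation.leibniz, smul_eq_mul, map_add, dA, map_neg]
    linear_combination A * dE
  induction n with
  | zero =>
    have h0 := gammaMu_two_mul hμ 0
    simp at h0
    simp [hA, hE, h0]
  | succ n ih =>
    have h := congrArg (coeff n) dv
    have h' : (n + 1) * (n + a) * coeff (n + 1) (A * E) +
        2 * (n + μ) * coeff n (A * E) = 0 := by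
      rcases n with _ | n
      · simp only [map_add, coeff_zero_X_mul, coeff_C_mul, coeff_derivative, map_zero] at h
        push_cast at h ⊢
        linear_combination h
      · simp only [map_add, coeff_succ_X_mul, coeff_C_mul, coeff_derivative, map_zero] at h
        push_cast at h ⊢
        linear_combination h
    rw [ih, ← ha] at h'
    have hp := (poch_pos (c := 2 * μ + 1) (by linarith) n).ne'
    have hn : (0 : ℝ) ≤ n := n.cast_nonneg
    rw [← ha] at hp ⊢
    have hq : (n : ℝ) + a ≠ 0 := by linarith
    have hf : ((n : ℝ) + 1) ≠ 0 := by positivity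
    rw [poch_succ, poch_succ, Nat.factorial_succ, pow_succ, add_comm a]
    push_cast
    apply mul_left_cancel₀ (mul_ne_zero hf hq)
    rw [eq_neg_of_add_eq_zero_left h']
    field_simp
    ring

/-- Splitting by parity, `γ_μ(2m)` and `γ_μ(2m + 1)` are, up to the factors `4^m` and `(2μ + 1)
4^m`, the denominators of the two Bessel series. -/
lemma hasSum_inv_gammaMu {μ : ℝ} (hμ : -(1 / 2) < μ) (z : ℂ) :
    Summable (fun n : ℕ => ‖((gammaMu μ n : ℝ) : ℂ)⁻¹ * z ^ n‖) ∧
    HasSum (fun n : ℕ => ((gammaMu μ n : ℝ) : ℂ)⁻¹ * z ^ n)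
      (besselSeries (μ + 1 / 2) (z ^ 2 / 4) +
        z / (2 * μ + 1) * besselSeries (μ + 3 / 2) (z ^ 2 / 4)) := by
  have hc : 0 < μ + 1 / 2 := by linarith
  have hc' : 0 < μ + 3 / 2 := by linarith
  have hne : (2 * μ + 1 : ℂ) ≠ 0 := by
    have : 2 * μ + 1 ≠ 0 := by linarith
    exact_mod_cast this
  have e0 : ∀ m : ℕ, ((gammaMu μ (2 * m) : ℝ) : ℂ)⁻¹ * z ^ (2 * m) =
      (z ^ 2 / 4) ^ m / ((m.factorial : ℂ) * (poch (μ + 1 / 2) m : ℂ)) := fun m => by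
    have h1 : (poch (μ + 1 / 2) m : ℂ) ≠ 0 := by exact_mod_cast (poch_pos hc m).ne'
    have h2 : (m.factorial : ℂ) ≠ 0 := by exact_mod_cast m.factorial_ne_zero
    rw [gammaMu_two_mul hμ, pow_mul, div_pow]
    push_cast
    field_simp
  have e1 : ∀ m : ℕ, ((gammaMu μ (2 * m + 1) : ℝ) : ℂ)⁻¹ * z ^ (2 * m + 1) = z / (2 * μ + 1) *
      ((z ^ 2 / 4) ^ m / ((m.factorial : ℂ) * (poch (μ + 3 / 2) m : ℂ))) := fun m => by
    have h1 : (poch (μ + 3 / 2) m : ℂ) ≠ 0 := by exact_mod_cast (poch_pos hc' m).ne'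
    have h2 : (m.factorial : ℂ) ≠ 0 := by exact_mod_cast m.factorial_ne_zero
    rw [gammaMu_two_mul_add_one hμ, pow_succ, pow_mul, div_pow]
    push_cast
    rw [show (μ + 1 / 2 : ℂ) = (2 * μ + 1) / 2 by ring]
    field_simp
  constructor
  · have s0 := summable_norm_besselSeries hc (z ^ 2 / 4)
    have s1 := (summable_norm_besselSeries hc' (z ^ 2 / 4)).mul_left ‖z / (2 * μ + 1)‖
    simp_rw [← norm_mul] at s1
    simp_rw [← e0] at s0
    simp_rw [← e1] at s1
    exact (s0.hasSum.even_add_odd (f := fun n : ℕ => ‖((gammaMu μ n : ℝ) : ℂ)⁻¹ * z ^ n‖)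
      s1.hasSum).summable
  · refine HasSum.even_add_odd ?_ ?_
    · simp_rw [e0]; exact hasSum_besselSeries hc _
    · simp_rw [e1]; exact (hasSum_besselSeries hc' _).mul_left _

/-- Kummer's second formula. -/
lemma expMu_eq {μ : ℝ} (hμ : -(1 / 2) < μ) (z : ℂ) :
    expMu μ z = besselSeries (μ + 1 / 2) (z ^ 2 / 4) +
        z / (2 * μ + 1) * besselSeries (μ + 3 / 2) (z ^ 2 / 4) := by
  obtain ⟨hs, hE⟩ := hasSum_inv_gammaMu hμ z
  set W := besselSeries (μ + 1 / 2) (z ^ 2 / 4) +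
        z / (2 * μ + 1) * besselSeries (μ + 3 / 2) (z ^ 2 / 4)
  have hexp : HasSum (fun k : ℕ => (-z) ^ k / (k.factorial : ℂ)) (Complex.exp (-z)) := by
    rw [Complex.exp_eq_exp_ℂ]; exact NormedSpace.expSeries_div_hasSum_exp (-z)
  have hes : Summable fun k : ℕ => ‖(-z) ^ k / (k.factorial : ℂ)‖ :=
    NormedSpace.norm_expSeries_div_summable (-z)
  have hprod := tsum_mul_tsum_eq_tsum_sum_antidiagonal_of_summable_norm hes hs
  rw [hexp.tsum_eq, hE.tsum_eq] at hprod
  have hconf : confluent μ (2 * μ + 1) (-2 * z) = Complex.exp (-z) * W := by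
    rw [hprod, confluent]
    refine tsum_congr fun n => ?_
    have h := congrArg (fun r : ℝ => (r : ℂ) * z ^ n) (coeff_exp_neg_mul_inv_gammaMu hμ n)
    push_cast [ofReal_poch] at h
    rw [Finset.sum_mul] at h
    rw [mul_pow]
    refine Eq.trans ?_ (h.symm.trans (Finset.sum_congr rfl fun p hp => ?_))
    · ring
    · rw [← Finset.HasAntidiagonal.mem_antidiagonal.mp hp, pow_add, neg_pow z]; ring
  rw [expMu, hconf, ← mul_assoc, ← Complex.exp_add]
  simp

/-! ### Linearization of products of binomial coefficients. -/

open PowerSeries in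
/-- The formal power series of `(1 - X) ^ (-b)`. -/
def negBinomialSeries (b : ℝ) : PowerSeries ℝ := PowerSeries.mk fun n => poch b n / n.factorial

open PowerSeries in
lemma one_sub_X_mul_negBinomialSeries (b : ℝ) :
    (1 - X) * negBinomialSeries (b + 1) = negBinomialSeries b := by
  ext n
  rw [sub_mul, one_mul, map_sub]
  rcases n with _ | n
  · simp [negBinomialSeries]
  · rw [coeff_succ_X_mul]
    simp only [negBinomialSeries, coeff_mk]
    rw [poch_succ_left b, poch_succ (b + 1), Nat.factorial_succ]
    push_cast
    field_simp
    ring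

open PowerSeries in
lemma derivative_negBinomialSeries (b : ℝ) :
    d⁄dX ℝ (negBinomialSeries b) = C b * negBinomialSeries (b + 1) := by
  ext n
  simp only [negBinomialSeries, coeff_derivative, coeff_C_mul, coeff_mk]
  rw [poch_succ_left, Nat.factorial_succ]
  push_cast
  field_simp

lemma cast_choose_succ_mul (n k : ℕ) :
    (n.choose (k + 1) : ℝ) * (k + 1) = (n.choose k : ℝ) * (n - k) := by
  rcases le_or_gt k n with h | h
  · have := Nat.choose_succ_right_eq n k
    rw [← Nat.cast_sub h]; exact_mod_cast this
  · rw [Nat.choose_eq_zero_of_lt h, Nat.choose_eq_zero_of_lt (by omega)]; simp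

/-- The coefficients of the linearization of `C(m, i) C(m, j)`. -/
def linCoeff (c : ℝ) (i j k : ℕ) : ℝ :=
  poch c i * poch c j / (i.factorial * j.factorial) *
    ((i.choose k : ℝ) * (j.choose k : ℝ) * (k.factorial / poch c k))

lemma linCoeff_succ_zero {c : ℝ} (i j : ℕ) :
    (j + 1) * linCoeff c i (j + 1) 0 = (c + j) * linCoeff c i j 0 := by
  simp only [linCoeff, poch_succ, Nat.factorial_succ, Nat.choose_zero_right]
  push_cast
  field_simp

lemma linCoeff_succ_succ {c : ℝ} (hc : 0 < c) (i j k : ℕ) :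
    (j + 1) * linCoeff c i (j + 1) (k + 1) =
      (i - k) * linCoeff c i j k + (c + (k + 1) + j) * linCoeff c i j (k + 1) := by
  have h1 := cast_choose_succ_mul i k
  have h2 := cast_choose_succ_mul j k
  have h3 := poch_ne_zero hc k
  have h4 : c + k ≠ 0 := by positivity
  simp only [linCoeff, poch_succ, Nat.factorial_succ, Nat.choose_succ_succ' j k]
  push_cast
  field_simp
  linear_combination poch c i * poch c j * ((c + k) * (j.choose k : ℝ) * h1
    - ((k : ℝ) + 1) * (i.choose (k + 1) : ℝ) * h2)

open PowerSeries in
-- Induction on `j`: because `(j + 1) C(m, j + 1) = (m - j) C(m, j)`, passing from `j` to `j + 1` is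
-- the operator `X d/dX - j` on generating functions, and `linCoeff` obeys the matching recurrence.
lemma mk_choose_mul_choose_eq {c : ℝ} (hc : 0 < c) (i j : ℕ) :
    (PowerSeries.mk fun m => poch c m / m.factorial * ((m.choose i : ℝ) * (m.choose j : ℝ))) =
      ∑ k ∈ Finset.range (j + 1),
        C (linCoeff c i j k) * (X ^ (i + (j - k)) * negBinomialSeries (c + i + j)) := by
  induction j with
  | zero =>
    ext m
    simp only [zero_add, Finset.sum_range_one, coeff_mk, coeff_C_mul, coeff_X_pow_mul',
      negBinomialSeries, Nat.sub_zero, add_zero, Nat.choose_zero_right, linCoeff]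
    split_ifs with h
    · obtain ⟨d, rfl⟩ := Nat.exists_eq_add_of_le h
      have h1 : ((i + d).choose i : ℝ) = (i + d).factorial / (i.factorial * d.factorial) := by
        rw [Nat.cast_choose ℝ (by omega), Nat.add_sub_cancel_left]
      rw [h1, poch_add, Nat.add_sub_cancel_left]
      have := Nat.factorial_ne_zero (i + d)
      simp
      field_simp
    · rw [Nat.choose_eq_zero_of_lt (by omega)]; simp
  | succ j ih =>
    set S : ℕ → PowerSeries ℝ := fun j =>
      PowerSeries.mk fun m => poch c m / m.factorial * ((m.choose i : ℝ) * (m.choose j : ℝ))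
    have hS : C ((j : ℝ) + 1) * S (j + 1) = X * d⁄dX ℝ (S j) - C (j : ℝ) * S j := by
      ext m
      have h := cast_choose_succ_mul m j
      rw [map_sub, coeff_C_mul, coeff_C_mul]
      rcases m with _ | m
      · rcases j with _ | j <;> simp [S]
      · rw [coeff_succ_X_mul, coeff_derivative]
        simp only [S, coeff_mk]
        push_cast at h ⊢
        linear_combination poch c (m + 1) / (m + 1).factorial * ((m + 1).choose i : ℝ) * h
    set N := negBinomialSeries (c + i + j + 1) with hN
    have hB : negBinomialSeries (c + i + j) = (1 - X) * N :=
      (one_sub_X_mul_negBinomialSeries _).symm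
    -- With every term written over `N = (1 - X)^(-(c + i + j + 1))`, the operator yields two
    -- neighbouring powers of `X`. Their coefficients `i - k` and `c + k + j` are those in
    -- `linCoeff_succ_succ`.
    have hterm : ∀ k ∈ Finset.range (j + 1),
        X * d⁄dX ℝ (C (linCoeff c i j k) * (X ^ (i + (j - k)) * negBinomialSeries (c + i + j))) -
          C (j : ℝ) * (C (linCoeff c i j k) * (X ^ (i + (j - k)) * negBinomialSeries (c + i + j)))
        = C ((i - k) * linCoeff c i j k) * (X ^ (i + (j - k)) * N) +
          C ((c + k + j) * linCoeff c i j k) * (X ^ (i + (j + 1 - k)) * N) := by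
      intro k hk
      have hk' : k ≤ j := by simpa [Nat.lt_succ_iff] using hk
      obtain ⟨d, rfl⟩ := Nat.exists_eq_add_of_le hk'
      have hX : (X : PowerSeries ℝ) * d⁄dX ℝ (X ^ (i + d)) = C ((i + d : ℕ) : ℝ) * X ^ (i + d) := by
        rcases Nat.eq_zero_or_pos (i + d) with h | h
        · rw [h]; simp
        · obtain ⟨e, he⟩ := Nat.exists_eq_succ_of_ne_zero h.ne'
          rw [he]
          simp only [Derivation.leibniz_pow, derivative_X, Nat.succ_eq_add_one,
            Nat.add_sub_cancel, nsmul_eq_mul, smul_eq_mul, mul_one, map_natCast]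
          ring
      rw [Nat.add_sub_cancel_left, show i + (k + d + 1 - k) = i + d + 1 by omega]
      simp only [Derivation.leibniz, smul_eq_mul, derivative_C, mul_zero, add_zero,
        derivative_negBinomialSeries]
      rw [← hN, hB]
      simp only [map_mul, map_sub, map_add, Nat.cast_add] at hX ⊢
      linear_combination C (linCoeff c i (k + d) k) * (1 - X) * N * hX
    have hmul : C ((j : ℝ) + 1) * S (j + 1) = C ((j : ℝ) + 1) * ∑ k ∈ Finset.range (j + 1 + 1),
        C (linCoeff c i (j + 1) k) *
          (X ^ (i + (j + 1 - k)) * negBinomialSeries (c + i + (j + 1 : ℕ))) := by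
      rw [hS, show S j = _ from ih, map_sum, Finset.mul_sum, Finset.mul_sum,
        ← Finset.sum_sub_distrib, Finset.sum_congr rfl hterm, Finset.sum_add_distrib,
        show c + i + (j + 1 : ℕ) = c + i + j + 1 by push_cast; ring, ← hN, Finset.mul_sum,
        Finset.sum_range_succ' _ (j + 1)]
      have hz : linCoeff c i j (j + 1) = 0 := by simp [linCoeff]
      have hext : ∑ k ∈ Finset.range (j + 1),
          C ((c + k + j) * linCoeff c i j k) * (X ^ (i + (j + 1 - k)) * N) =
          ∑ k ∈ Finset.range (j + 1 + 1),
          C ((c + k + j) * linCoeff c i j k) * (X ^ (i + (j + 1 - k)) * N) := by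
        rw [Finset.sum_range_succ _ (j + 1), hz]; simp
      rw [hext, Finset.sum_range_succ' _ (j + 1), ← add_assoc, ← Finset.sum_add_distrib]
      congr 1
      · refine Finset.sum_congr rfl fun k _ => ?_
        rw [← mul_assoc (C ((j : ℝ) + 1)), ← map_mul, linCoeff_succ_succ hc, map_add,
          Nat.add_sub_add_right]
        push_cast
        ring
      · rw [← mul_assoc (C ((j : ℝ) + 1)), ← map_mul, linCoeff_succ_zero]
        simp
    have hne : (C ((j : ℝ) + 1) : PowerSeries ℝ) ≠ 0 := by
      rw [Ne, map_eq_zero_iff _ PowerSeries.C_injective]; positivity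
    exact mul_left_cancel₀ hne hmul

lemma poch_mul_choose_mul_choose {c : ℝ} (hc : 0 < c) (m i j : ℕ) :
    poch c m / m.factorial * ((m.choose i : ℝ) * (m.choose j : ℝ)) =
      ∑ k ∈ Finset.range (j + 1), if i + (j - k) ≤ m then
        linCoeff c i j k *
          (poch (c + i + j) (m - (i + (j - k))) / (m - (i + (j - k))).factorial) else 0 := by
  have h := congrArg (PowerSeries.coeff m) (mk_choose_mul_choose_eq hc i j)
  simpa only [PowerSeries.coeff_mk, map_sum, PowerSeries.coeff_C_mul, PowerSeries.coeff_X_pow_mul',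
    negBinomialSeries, mul_ite, mul_zero] using h

/-! ### The Hille–Hardy formula. -/

lemma hasSum_negBinomial (b : ℝ) {w : ℂ} (hw : ‖w‖ < 1) :
    HasSum (fun n : ℕ => ((poch b n / n.factorial : ℝ) : ℂ) * w ^ n) (1 / (1 - w) ^ (b : ℂ)) := by
  have h := (Complex.one_div_one_sub_cpow_hasFPowerSeriesOnBall_zero (b : ℂ)).hasSum (y := w)
    (by rw [mem_eball_zero_iff, ← ofReal_norm, ENNReal.ofReal_lt_one]; exact hw)
  simp only [zero_add] at h
  refine (congrArg (HasSum · _) (funext fun n => ?_)).mpr h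
  have h1 := Ring.factorial_nsmul_multichoose_eq_ascPochhammer (b : ℂ) n
  rw [Polynomial.ascPochhammer_smeval_eq_eval, ← ofReal_poch, nsmul_eq_mul, Ring.multichoose_eq] at h1
  have h2 : (n.factorial : ℂ) ≠ 0 := by exact_mod_cast n.factorial_ne_zero
  rw [FormalMultilinearSeries.ofScalars_apply_eq, smul_eq_mul]
  push_cast
  rw [← h1]
  field_simp

lemma hasSum_negBinomial_real {b : ℝ} {r : ℝ} (h0 : 0 ≤ r) (h1 : r < 1) :
    HasSum (fun n : ℕ => poch b n / n.factorial * r ^ n) (1 / (1 - r) ^ b) := by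
  have h := hasSum_negBinomial b (w := (r : ℂ)) (by simpa [abs_of_nonneg h0] using h1)
  rw [← Complex.hasSum_ofReal]
  convert h using 2
  · push_cast; ring
  · push_cast
    rw [Complex.ofReal_cpow (by linarith)]
    simp

lemma summable_prod_of_hasSum_norm {α β : Type*} {f : α × β → ℂ} {N : α → ℝ}
    (h : ∀ a, HasSum (fun b => ‖f (a, b)‖) (N a)) (hN : Summable N) : Summable f := by
  refine Summable.of_norm ((summable_prod_of_nonneg fun _ => norm_nonneg _).mpr
    ⟨fun a => (h a).summable, ?_⟩)
  simpa only [fun a => (h a).tsum_eq] using hN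

/-- The terms of the expansion of the Hille–Hardy kernel, indexed by `(k, a, b)` and `n`. -/
def hilleHardyTerm (c x y : ℝ) (w : ℂ) (p : (ℕ × ℕ × ℕ) × ℕ) : ℂ :=
  w ^ (p.1.1 + p.1.2.1 + p.1.2.2) * (-x : ℂ) ^ (p.1.1 + p.1.2.1) * (-y : ℂ) ^ (p.1.1 + p.1.2.2) /
    ((p.1.1.factorial : ℂ) * (poch c p.1.1 : ℂ) * (p.1.2.1.factorial : ℂ) *
      (p.1.2.2.factorial : ℂ)) *
    (((poch (c + (p.1.1 + p.1.2.1 : ℕ) + (p.1.1 + p.1.2.2 : ℕ)) p.2 / p.2.factorial : ℝ) : ℂ) *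
      w ^ p.2)

lemma one_sub_ne_zero_of_norm_lt {w : ℂ} (hw : ‖w‖ < 1) : 1 - w ≠ 0 := by
  intro h
  rw [← sub_eq_zero.mp h] at hw
  simp at hw

/-- Stated over an arbitrary field since it serves twice: over `ℝ` for the norms and over `ℂ` for
the terms. -/
lemma hilleHardy_algebra {F : Type*} [Field F] (w v Z X Y : F)
    (k a b : ℕ) (f p f' f'' : F) :
    w ^ (k + a + b) * X ^ (k + a) * Y ^ (k + b) / (f * p * f' * f'') *
        (1 / (Z * v ^ (k + a + (k + b)))) =
      1 / Z * ((X * Y * (w / v ^ 2)) ^ k / (f * p) *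
        ((X * (w / v)) ^ a / f' * ((Y * (w / v)) ^ b / f''))) := by
  simp only [mul_pow, div_eq_mul_inv, inv_pow, pow_add, mul_inv, one_mul]
  ring

/-- Taking norms replaces `w, -x, -y` by `‖w‖, |x|, |y|` and keeps the shape of the term. The sum
over `n` is then a real binomial series, and what is left is a product of a Bessel series and two
exponential series. -/
lemma summable_hilleHardyTerm {c : ℝ} (hc : 0 < c) (x y : ℝ) {w : ℂ} (hw : ‖w‖ < 1) :
    Summable (hilleHardyTerm c x y w) := by
  set B : ℝ → ℕ → ℝ := fun x a => (|x| * (‖w‖ / (1 - ‖w‖))) ^ a / (a.factorial : ℝ)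
  have hB : ∀ x, Summable (B x) := fun x => Real.summable_pow_div_factorial _
  have hB0 : ∀ x, 0 ≤ B x := fun x a => by
    have : 0 ≤ 1 - ‖w‖ := by linarith
    simp only [B, Pi.zero_apply]; positivity
  refine summable_prod_of_hasSum_norm (N := fun q : ℕ × ℕ × ℕ => 1 / (1 - ‖w‖) ^ c *
    ((|x| * |y| * (‖w‖ / (1 - ‖w‖) ^ 2)) ^ q.1 / (q.1.factorial * poch c q.1) *
      (B x q.2.1 * B y q.2.2))) ?_ ?_
  · rintro ⟨k, a, b⟩
    have h := (hasSum_negBinomial_real (b := c + (k + a : ℕ) + (k + b : ℕ))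
      (norm_nonneg w) hw).mul_left (‖w‖ ^ (k + a + b) * |x| ^ (k + a) * |y| ^ (k + b) /
      ((k.factorial : ℝ) * (poch c k : ℝ) * (a.factorial : ℝ) * (b.factorial : ℝ)))
    rw [show (c + (k + a : ℕ) + (k + b : ℕ) : ℝ) = c + ((k + a + (k + b) : ℕ) : ℝ) by
      push_cast; ring, Real.rpow_add (by linarith), Real.rpow_natCast,
      hilleHardy_algebra] at h
    refine (congrArg (HasSum · _) (funext fun n => ?_)).mpr h
    have hp : 0 < poch (c + ((k + a + (k + b) : ℕ) : ℝ)) n := poch_pos (by positivity) n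
    simp only [hilleHardyTerm, norm_mul, norm_div, norm_pow, norm_neg, Complex.norm_real,
      Complex.norm_natCast, Real.norm_eq_abs, abs_of_pos (poch_pos hc k)]
    rw [show (c + (k + a : ℕ) + (k + b : ℕ) : ℝ) = c + ((k + a + (k + b) : ℕ) : ℝ) by
      push_cast; ring, abs_of_pos hp, Nat.abs_cast]
  · refine Summable.mul_left _ (Summable.mul_of_nonneg (summable_besselSeries_real hc _)
      ((hB x).mul_of_nonneg (hB y) (hB0 x) (hB0 y)) ?_ ?_)
    · intro k
      have := poch_pos hc k
      simp only [Pi.zero_apply]; positivity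
    · intro q
      exact mul_nonneg (hB0 x _) (hB0 y _)

lemma hasSum_hilleHardyTerm_inner (c x y : ℝ) {w : ℂ} (hw : ‖w‖ < 1) (k a b : ℕ) :
    HasSum (fun n => hilleHardyTerm c x y w ((k, a, b), n))
      (1 / (1 - w) ^ (c : ℂ) *
        ((x * y * (w / (1 - w) ^ 2)) ^ k / ((k.factorial : ℂ) * (poch c k : ℂ)) *
          ((-x * (w / (1 - w))) ^ a / (a.factorial : ℂ) *
            ((-y * (w / (1 - w))) ^ b / (b.factorial : ℂ))))) := by
  have h := (hasSum_negBinomial (c + (k + a : ℕ) + (k + b : ℕ)) hw).mul_left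
    (w ^ (k + a + b) * (-x : ℂ) ^ (k + a) * (-y : ℂ) ^ (k + b) /
      ((k.factorial : ℂ) * (poch c k : ℂ) * (a.factorial : ℂ) * (b.factorial : ℂ)))
  rw [show ((c + (k + a : ℕ) + (k + b : ℕ) : ℝ) : ℂ) =
    (c : ℂ) + ((k + a + (k + b) : ℕ) : ℂ) by push_cast; ring,
    Complex.cpow_add _ _ (one_sub_ne_zero_of_norm_lt hw), Complex.cpow_natCast,
    hilleHardy_algebra, neg_mul_neg] at h
  exact h

lemma hasSum_mul_mul {f g h : ℕ → ℂ} {a b c : ℂ} (hf : HasSum f a) (hg : HasSum g b)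
    (hh : HasSum h c) (hfn : Summable fun i => ‖f i‖) (hgn : Summable fun i => ‖g i‖)
    (hhn : Summable fun i => ‖h i‖) :
    HasSum (fun q : ℕ × ℕ × ℕ => f q.1 * (g q.2.1 * h q.2.2)) (a * (b * c)) := by
  have h2 : HasSum (fun q : ℕ × ℕ => g q.1 * h q.2) (b * c) :=
    hg.mul hh (summable_mul_of_summable_norm hgn hhn)
  have h3 : Summable fun q : ℕ × ℕ × ℕ => f q.1 * (g q.2.1 * h q.2.2) :=
    summable_mul_of_summable_norm (f := f) (g := fun q : ℕ × ℕ => g q.1 * h q.2) hfn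
      (hgn.mul_norm hhn)
  have h4 := h3.hasSum
  rwa [(h4.prod_fiberwise fun k => h2.mul_left (f k)).unique (hf.mul_right _)] at h4

lemma hasSum_hilleHardyTerm {c : ℝ} (hc : 0 < c) (x y : ℝ) {w : ℂ} (hw : ‖w‖ < 1) :
    HasSum (hilleHardyTerm c x y w)
      (1 / (1 - w) ^ (c : ℂ) * Complex.exp (-(x + y) * (w / (1 - w))) *
        besselSeries c (x * y * (w / (1 - w) ^ 2))) := by
  have hsum := (summable_hilleHardyTerm hc x y hw).hasSum
  have hK := hasSum_besselSeries hc (x * y * (w / (1 - w) ^ 2))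
  have hA : ∀ s : ℂ, HasSum (fun a : ℕ => s ^ a / (a.factorial : ℂ)) (Complex.exp s) :=
    fun s => by
    rw [Complex.exp_eq_exp_ℂ]; exact NormedSpace.expSeries_div_hasSum_exp _
  have hAn : ∀ s : ℂ, Summable fun a : ℕ => ‖s ^ a / (a.factorial : ℂ)‖ := fun s =>
    NormedSpace.norm_expSeries_div_summable s
  have hP := (hasSum_mul_mul hK (hA (-x * (w / (1 - w)))) (hA (-y * (w / (1 - w))))
    (summable_norm_besselSeries hc _) (hAn _) (hAn _)).mul_left (1 / (1 - w) ^ (c : ℂ))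
  have hval := (hsum.prod_fiberwise
    fun q => hasSum_hilleHardyTerm_inner c x y hw q.1 q.2.1 q.2.2).unique hP
  rw [hval, ← Complex.exp_add] at hsum
  convert hsum using 1
  rw [mul_assoc, mul_comm (Complex.exp _)]
  congr 3
  ring

/-- The Hille–Hardy formula. -/
lemma hasSum_confluentPoly_mul_confluentPoly {c : ℝ} (hc : 0 < c) (x y : ℝ) {w : ℂ}
    (hw : ‖w‖ < 1) :
    HasSum (fun m : ℕ => ((poch c m / m.factorial *
        (confluentPoly m c x * confluentPoly m c y) : ℝ) : ℂ) * w ^ m)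
      (1 / (1 - w) ^ (c : ℂ) * Complex.exp (-(x + y) * (w / (1 - w))) *
        besselSeries c (x * y * (w / (1 - w) ^ 2))) := by
  -- Reindexing by `i = k + a`, `j = k + b`, `m = n + k + a + b`. The image is the region `k ≤ min i
  -- j`, `i + j - k ≤ m`, outside which the linearized term `g` vanishes.
  set e : (ℕ × ℕ × ℕ) × ℕ → ℕ × ((ℕ × ℕ) × ℕ) := fun p =>
    (p.2 + (p.1.1 + p.1.2.1 + p.1.2.2), ((p.1.1 + p.1.2.1, p.1.1 + p.1.2.2), p.1.1)) with he
  have hinj : Function.Injective e := by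
    rintro ⟨⟨k, a, b⟩, n⟩ ⟨⟨k', a', b'⟩, n'⟩ h
    simp only [he, Prod.mk.injEq] at h ⊢
    omega
  set g : ℕ × ((ℕ × ℕ) × ℕ) → ℂ := fun q =>
    ((((-x) ^ q.2.1.1 / poch c q.2.1.1) * ((-y) ^ q.2.1.2 / poch c q.2.1.2) *
      (if q.2.1.1 + (q.2.1.2 - q.2.2) ≤ q.1 then linCoeff c q.2.1.1 q.2.1.2 q.2.2 *
          (poch (c + q.2.1.1 + q.2.1.2) (q.1 - (q.2.1.1 + (q.2.1.2 - q.2.2))) /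
            (q.1 - (q.2.1.1 + (q.2.1.2 - q.2.2))).factorial) else 0) : ℝ) : ℂ) * w ^ q.1 with hg
  have hge : ∀ p, g (e p) = hilleHardyTerm c x y w p := by
    rintro ⟨⟨k, a, b⟩, n⟩
    have h1 : k + a + (k + b - k) ≤ n + (k + a + b) := by omega
    have h2 : n + (k + a + b) - (k + a + (k + b - k)) = n := by omega
    have h3 : linCoeff c (k + a) (k + b) k =
        poch c (k + a) * poch c (k + b) / (k.factorial * poch c k * a.factorial * b.factorial) := by
      rw [linCoeff, Nat.cast_choose ℝ (Nat.le_add_right k a),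
        Nat.cast_choose ℝ (Nat.le_add_right k b), Nat.add_sub_cancel_left, Nat.add_sub_cancel_left]
      have := (k + a).factorial_ne_zero
      have := (k + b).factorial_ne_zero
      field_simp
    have h4 := poch_ne_zero hc (k + a)
    have h5 := poch_ne_zero hc (k + b)
    simp only [hg, he, hilleHardyTerm, h1, h2, if_true, h3]
    have h6 : ((-x) ^ (k + a) / poch c (k + a)) * ((-y) ^ (k + b) / poch c (k + b)) *
        (poch c (k + a) * poch c (k + b) / (k.factorial * poch c k * a.factorial * b.factorial) *
        (poch (c + (k + a : ℕ) + (k + b : ℕ)) n / n.factorial)) =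
        (-x) ^ (k + a) * (-y) ^ (k + b) / (k.factorial * poch c k * a.factorial * b.factorial) *
        (poch (c + (k + a : ℕ) + (k + b : ℕ)) n / n.factorial) := by
      field_simp
    rw [h6, pow_add w n]
    simp only [Complex.ofReal_mul, Complex.ofReal_div, Complex.ofReal_pow, Complex.ofReal_neg,
      Complex.ofReal_natCast]
    ring
  have hg0 : ∀ q, q ∉ Set.range e → g q = 0 := by
    rintro ⟨m, ⟨⟨i, j⟩, k⟩⟩ hq
    simp only [hg]
    by_cases hki : k ≤ i
    · by_cases hkj : k ≤ j
      · by_cases hm : i + (j - k) ≤ m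
        · refine absurd ⟨((k, i - k, j - k), m - (i + (j - k))), ?_⟩ hq
          refine Prod.ext ?_ (Prod.ext (Prod.ext ?_ ?_) rfl) <;> simp only [he] <;> omega
        · rw [if_neg hm]; simp
      · simp [linCoeff, Nat.choose_eq_zero_of_lt (not_le.mp hkj)]
    · simp [linCoeff, Nat.choose_eq_zero_of_lt (not_le.mp hki)]
  have hG : HasSum g _ := (hinj.hasSum_iff hg0).mp
    (by rw [show g ∘ e = _ from funext hge]; exact hasSum_hilleHardyTerm hc x y hw)
  refine hG.prod_fiberwise fun m => ?_
  have hz : ∀ r ∉ (Finset.range (m + 1) ×ˢ Finset.range (m + 1)) ×ˢ Finset.range (m + 1),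
      g (m, r) = 0 := by
    rintro ⟨⟨i, j⟩, k⟩ hr
    refine hg0 _ ?_
    rintro ⟨⟨⟨k', a, b⟩, n⟩, h⟩
    simp only [he, Prod.mk.injEq] at h
    simp only [Finset.mem_product, Finset.mem_range] at hr
    omega
  have hfin : HasSum (fun r => g (m, r)) _ := hasSum_sum_of_ne_finset_zero hz
  convert hfin using 1
  rw [confluentPoly_eq_sum m hc, confluentPoly_eq_sum m hc, Finset.sum_product]
  simp only [hg]
  simp_rw [← Finset.sum_mul, ← Complex.ofReal_sum]
  congr 2
  rw [Finset.sum_mul_sum, Finset.mul_sum, Finset.sum_product]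
  refine Finset.sum_congr rfl fun i _ => ?_
  rw [Finset.mul_sum]
  refine Finset.sum_congr rfl fun j hj => ?_
  rw [← Finset.mul_sum]
  have hs := poch_mul_choose_mul_choose hc m i j
  -- The linearization sums over `k ≤ j`; it extends to `k ≤ m` because `C(j, k) = 0` beyond `j`.
  rw [Finset.sum_subset (s₂ := Finset.range (m + 1))
    (by intro t; simp only [Finset.mem_range] at hj ⊢; omega) (fun k _ hk => by
      rw [linCoeff, Nat.choose_eq_zero_of_lt (n := j) (k := k) (by simpa using hk)]; simp)] at hs
  rw [← hs]
  ring

/-! ### Reduction to Laguerre functions and the Mehler formula. -/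

lemma hasSum_of_eq {f g : ℕ → ℂ} {a b : ℂ} (h : HasSum g b) (hf : ∀ n, f n = g n) (hab : a = b) :
    HasSum f a := by
  rwa [funext hf, hab]

/-- The normalized Laguerre functions of order `c - 1` in the variable `x ^ 2`. -/
def laguerreFun (c : ℝ) (m : ℕ) (x : ℝ) : ℝ :=
  (-1) ^ m * √(poch c m / (m.factorial * Real.Gamma c)) *
    (Real.exp (-(1 / 2) * x ^ 2) * confluentPoly m c (x ^ 2))

lemma hermiteFun_two_mul {μ : ℝ} (hμ : -(1 / 2) < μ) (m : ℕ) (x : ℝ) :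
    hermiteFun μ (2 * m) x = laguerreFun (μ + 1 / 2) m x := by
  have hc : 0 < μ + 1 / 2 := by linarith
  have hG := Real.Gamma_pos_of_pos hc
  have hp := poch_pos hc m
  have hf : ((2 * m).factorial : ℝ) ≠ 0 := by exact_mod_cast (2 * m).factorial_ne_zero
  rw [hermiteFun, hermiteH, if_pos (even_two_mul m), Nat.mul_div_cancel_left m two_pos,
    gammaMu_two_mul hμ, ← Real.sqrt_eq_rpow, laguerreFun,
    show ((2 * m : ℕ) : ℝ) / 2 = m by push_cast; ring, Real.rpow_natCast]
  have h4 : (4 : ℝ) ^ m = 2 ^ m * 2 ^ m := by rw [← mul_pow]; norm_num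
  have hs : √(4 ^ m * m.factorial * poch (μ + 1 / 2) m / Real.Gamma (μ + 1 / 2)) =
      2 ^ m * m.factorial * √(poch (μ + 1 / 2) m / (m.factorial * Real.Gamma (μ + 1 / 2))) := by
    rw [show 4 ^ m * m.factorial * poch (μ + 1 / 2) m / Real.Gamma (μ + 1 / 2) =
      (2 ^ m * m.factorial) ^ 2 * (poch (μ + 1 / 2) m / (m.factorial * Real.Gamma (μ + 1 / 2))) by
      rw [h4]
      generalize Real.Gamma (μ + 1 / 2) = G at *
      generalize poch (μ + 1 / 2) m = P at *
      field_simp, Real.sqrt_mul (by positivity), Real.sqrt_sq (by positivity)]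
  rw [hs]
  field_simp

lemma hermiteFun_two_mul_add_one {μ : ℝ} (hμ : -(1 / 2) < μ) (m : ℕ) (x : ℝ) :
    hermiteFun μ (2 * m + 1) x = x * laguerreFun (μ + 3 / 2) m x := by
  have hc : 0 < μ + 1 / 2 := by linarith
  have hG := Real.Gamma_pos_of_pos hc
  have hp := poch_pos (c := μ + 3 / 2) (by linarith) m
  have hf : ((2 * m + 1).factorial : ℝ) ≠ 0 := by exact_mod_cast (2 * m + 1).factorial_ne_zero
  have hΓ : Real.Gamma (μ + 3 / 2) = (μ + 1 / 2) * Real.Gamma (μ + 1 / 2) := by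
    rw [← Real.Gamma_add_one hc.ne']; congr 1; ring
  rw [hermiteFun, hermiteH, if_neg (by simp), show (2 * m + 1) / 2 = m by omega,
    gammaMu_two_mul_add_one hμ, ← Real.sqrt_eq_rpow, laguerreFun, hΓ,
    show ((2 * m + 1 : ℕ) : ℝ) / 2 = m + 1 / 2 by push_cast; ring,
    Real.rpow_add two_pos, Real.rpow_natCast, ← Real.sqrt_eq_rpow]
  have h4 : (4 : ℝ) ^ m = 2 ^ m * 2 ^ m := by rw [← mul_pow]; norm_num
  generalize confluentPoly m (μ + 3 / 2) (x ^ 2) = Q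
  generalize Real.Gamma (μ + 1 / 2) = G at *
  generalize poch (μ + 3 / 2) m = P at *
  generalize μ + 1 / 2 = c at *
  have hs : √(2 * 4 ^ m * m.factorial * (c * P) / G) =
      √2 * (2 ^ m * m.factorial * c * √(P / (m.factorial * (c * G)))) := by
    rw [show 2 * 4 ^ m * m.factorial * (c * P) / G =
      2 * ((2 ^ m * m.factorial * c) ^ 2 * (P / (m.factorial * (c * G)))) by
      rw [h4]; field_simp, Real.sqrt_mul (by positivity), Real.sqrt_mul (by positivity),
      Real.sqrt_sq (by positivity)]
  have h2 : √(2 : ℝ) ≠ 0 := by positivity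
  rw [hs]
  field_simp

/-- Hille–Hardy at `x²`, `y²`; the Gaussians merge with its exponential because `1/2 + w/(1 - w) =
(1/2)(1 + w)/(1 - w)`. -/
lemma hasSum_laguerreFun_mul {c : ℝ} (hc : 0 < c) (x y : ℝ) {w : ℂ} (hw : ‖w‖ < 1) :
    HasSum (fun m : ℕ => (laguerreFun c m x : ℂ) * (laguerreFun c m y : ℂ) * w ^ m)
      (1 / (Real.Gamma c : ℂ) * (1 / (1 - w) ^ (c : ℂ)) *
        Complex.exp (-(1 / 2) * ((x : ℂ) ^ 2 + (y : ℂ) ^ 2) * ((1 + w) / (1 - w))) *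
        besselSeries c ((x : ℂ) ^ 2 * (y : ℂ) ^ 2 * (w / (1 - w) ^ 2))) := by
  have hG := Real.Gamma_pos_of_pos hc
  have hw0 := one_sub_ne_zero_of_norm_lt hw
  have h := (hasSum_confluentPoly_mul_confluentPoly hc (x ^ 2) (y ^ 2) hw).mul_left
    (1 / (Real.Gamma c : ℂ) * Complex.exp (-(1 / 2) * ((x : ℂ) ^ 2 + (y : ℂ) ^ 2)))
  have hexp : Complex.exp (-(1 / 2) * ((x : ℂ) ^ 2 + (y : ℂ) ^ 2) * ((1 + w) / (1 - w))) =
      Complex.exp (-(1 / 2) * ((x : ℂ) ^ 2 + (y : ℂ) ^ 2)) *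
        Complex.exp (-((x : ℂ) ^ 2 + (y : ℂ) ^ 2) * (w / (1 - w))) := by
    rw [← Complex.exp_add]
    congr 1
    field_simp
    ring
  rw [hexp]
  refine hasSum_of_eq h (fun m => ?_) ?_
  · have hp := poch_pos hc m
    have hsq : laguerreFun c m x * laguerreFun c m y =
        1 / Real.Gamma c * Real.exp (-(1 / 2) * (x ^ 2 + y ^ 2)) * (poch c m / m.factorial *
          (confluentPoly m c (x ^ 2) * confluentPoly m c (y ^ 2))) := by
      have h1 : ((-1 : ℝ) ^ m) * (-1) ^ m = 1 := by rw [← mul_pow]; simp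
      have h2 : √(poch c m / (m.factorial * Real.Gamma c)) *
          √(poch c m / (m.factorial * Real.Gamma c)) = poch c m / (m.factorial * Real.Gamma c) :=
        Real.mul_self_sqrt (by positivity)
      have h3 : poch c m / (m.factorial * Real.Gamma c) =
        1 / Real.Gamma c * (poch c m / m.factorial) := by field_simp
      rw [h3] at h2
      rw [mul_add, Real.exp_add, laguerreFun, laguerreFun, h3]
      generalize √(1 / Real.Gamma c * (poch c m / m.factorial)) = S at *
      generalize Real.exp (-(1 / 2) * x ^ 2) = e1
      generalize Real.exp (-(1 / 2) * y ^ 2) = e2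
      generalize confluentPoly m c (x ^ 2) = p1
      generalize confluentPoly m c (y ^ 2) = p2
      linear_combination e1 * p1 * e2 * p2 * S * S * h1 + e1 * p1 * e2 * p2 * h2
    have := congrArg (fun r : ℝ => (r : ℂ) * w ^ m) hsq
    push_cast at this ⊢
    rw [this]; ring
  · push_cast
    ring

/-- The Mehler formula for the generalized Hermite functions. -/
lemma hasSum_hermiteFun_mul {μ : ℝ} (hμ : -(1 / 2) < μ) (x y : ℝ) {z : ℂ} (hz : ‖z‖ < 1) :
    HasSum
        (fun n : ℕ => (hermiteFun μ n x : ℂ) * (hermiteFun μ n y : ℂ) * z ^ n)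
        (1 / (Real.Gamma (μ + 1 / 2) : ℂ) *
          (1 / (1 - z ^ 2) ^ ((μ : ℂ) + 1 / 2)) *
          Complex.exp (-(1 / 2) * ((x : ℂ) ^ 2 + (y : ℂ) ^ 2) * ((1 + z ^ 2) / (1 - z ^ 2))) *
          expMu μ (2 * (x : ℂ) * (y : ℂ) * (z / (1 - z ^ 2)))) := by
  have hc : 0 < μ + 1 / 2 := by linarith
  have hz2 : ‖z ^ 2‖ < 1 := by rw [norm_pow]; exact pow_lt_one₀ (norm_nonneg z) hz two_ne_zero
  have hw0 := one_sub_ne_zero_of_norm_lt hz2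
  have h0 := hasSum_laguerreFun_mul hc x y hz2
  have h1 := (hasSum_laguerreFun_mul (c := μ + 3 / 2) (by linarith) x y hz2).mul_left (x * y * z)
  have h := HasSum.even_add_odd
    (f := fun n : ℕ => (hermiteFun μ n x : ℂ) * (hermiteFun μ n y : ℂ) * z ^ n)
    (by simpa only [hermiteFun_two_mul hμ, pow_mul] using h0)
    ((congrArg (HasSum · _) (funext fun m => by
      rw [hermiteFun_two_mul_add_one hμ, hermiteFun_two_mul_add_one hμ, pow_succ, pow_mul]
      push_cast
      ring)).mpr h1)
  convert h using 1
  have hΓ : Real.Gamma (μ + 3 / 2) = (μ + 1 / 2) * Real.Gamma (μ + 1 / 2) := by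
    rw [← Real.Gamma_add_one hc.ne']; congr 1; ring
  have hpow : (1 - z ^ 2) ^ ((μ + 3 / 2 : ℝ) : ℂ) =
      (1 - z ^ 2) ^ ((μ : ℂ) + 1 / 2) * (1 - z ^ 2) := by
    rw [show ((μ + 3 / 2 : ℝ) : ℂ) = (μ : ℂ) + 1 / 2 + 1 by push_cast; ring,
      Complex.cpow_add _ _ hw0, Complex.cpow_one]
  have harg : (2 * (x : ℂ) * y * (z / (1 - z ^ 2))) ^ 2 / 4 =
      (x : ℂ) ^ 2 * (y : ℂ) ^ 2 * (z ^ 2 / (1 - z ^ 2) ^ 2) := by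
    field_simp
    ring
  have hne : (2 * μ + 1 : ℂ) ≠ 0 := by
    have : 2 * μ + 1 ≠ 0 := by linarith
    exact_mod_cast this
  -- Both parities share the Gaussian factor. The extra `1 / ((μ + 1/2)(1 - z²))` of the odd half,
  -- times `xyz`, is exactly the prefactor of the odd Bessel series in `e_μ`.
  rw [expMu_eq hμ, harg, hΓ, hpow, mul_add]
  congr 1
  · push_cast; ring
  · push_cast
    rw [show (μ + 1 / 2 : ℂ) = (2 * μ + 1) / 2 by ring]
    generalize besselSeries (μ + 3 / 2) _ = K
    generalize Complex.exp _ = E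
    generalize (Real.Gamma (μ + 1 / 2) : ℂ) = G
    generalize (1 - z ^ 2) ^ ((2 * μ + 1 : ℂ) / 2) = Z
    simp only [div_eq_mul_inv, mul_inv, inv_inv]
    ring

/-! ### Gaussian moments and orthogonality of Laguerre functions. -/

lemma integrable_tsum_of_summable_integral_norm {F : ℕ → ℝ → ℝ} (hF : ∀ i, Integrable (F i))
    (hsum : Summable fun i => ∫ t, ‖F i t‖) (hs : ∀ t, Summable fun i => F i t) :
    Integrable fun t => ∑' i, F i t := by
  refine ⟨aestronglyMeasurable_of_tendsto_ae Filter.atTop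
    (f := fun n t => ∑ i ∈ Finset.range n, F i t)
    (fun n => Finset.aestronglyMeasurable_fun_sum _ fun i _ => (hF i).1)
    (Filter.Eventually.of_forall fun t => (hs t).hasSum.tendsto_sum_nat), ?_⟩
  have hfin : ∑' i, ∫⁻ t, ‖F i t‖ₑ ≠ ⊤ := by
    have (i : ℕ) : ∫⁻ t, ‖F i t‖ₑ = ENNReal.ofReal (∫ t, ‖F i t‖) := by
      rw [← ofReal_integral_norm_eq_lintegral_enorm (hF i)]
    simp_rw [this]
    exact hsum.tsum_ofReal_ne_top
  refine lt_of_le_of_lt (lintegral_mono fun t => ?_)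
    ((lintegral_tsum fun i => (hF i).1.enorm).trans_lt hfin.lt_top)
  exact enorm_tsum_le_tsum_enorm

lemma integral_eq_zero_of_odd {E : Type*} [NormedAddCommGroup E] [NormedSpace ℝ E] {f : ℝ → E}
    (hf : ∀ t, f (-t) = -f t) : ∫ t, f t = 0 := by
  have h := integral_neg_eq_self f volume
  simp only [hf, integral_neg] at h
  have h2 : (2 : ℝ) • ∫ t, f t = 0 := by
    rw [two_smul]; nth_rewrite 1 [← h]; exact neg_add_cancel _
  exact (smul_eq_zero.mp h2).resolve_left two_ne_zero

lemma integral_exp_mul_abs_rpow {b s : ℝ} (hb : 0 < b) (hs : 0 < s) :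
    ∫ t : ℝ, Real.exp (-s * t ^ 2) * |t| ^ (2 * b - 1) = s ^ (-b) * Real.Gamma b := by
  have h := integral_comp_abs (f := fun u => Real.exp (-s * u ^ 2) * u ^ (2 * b - 1))
  simp only [sq_abs] at h
  have h2 := integral_rpow_mul_exp_neg_mul_rpow (p := 2) (q := 2 * b - 1) two_pos
    (by linarith) hs
  simp only [Real.rpow_two] at h2
  rw [show (2 * b - 1 + 1) / 2 = b by ring, show -(2 * b - 1 + 1) / 2 = -b by ring] at h2
  rw [h]
  simp_rw [mul_comm (Real.exp _)]
  rw [h2]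
  ring

lemma integrable_exp_mul_abs_rpow {b s : ℝ} (hb : 0 < b) (hs : 0 < s) :
    Integrable fun t : ℝ => Real.exp (-s * t ^ 2) * |t| ^ (2 * b - 1) := by
  -- A non-integrable function has integral `0` by convention, so the positive value already
  -- computed proves integrability.
  refine Integrable.of_integral_ne_zero ?_
  rw [integral_exp_mul_abs_rpow hb hs]
  have := Real.Gamma_pos_of_pos hb
  positivity

/-- At `t = 0` this can fail: the exponent on the right may be `0`, and `0 ^ 0 = 1`. Later uses are
therefore almost everywhere. -/
lemma abs_pow_mul_abs_rpow {t : ℝ} (ht : t ≠ 0) (c : ℝ) (n : ℕ) :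
    |t| ^ n * |t| ^ (2 * c - 1) = |t| ^ (2 * (c + n / 2) - 1) := by
  rw [← Real.rpow_natCast, ← Real.rpow_add (abs_pos.mpr ht)]
  congr 1
  ring

lemma ae_ne_zero : ∀ᵐ t : ℝ, t ≠ 0 := by simp [ae_iff]

lemma integrable_pow_mul_exp_mul_abs_rpow {c s : ℝ} (hc : 0 < c) (hs : 0 < s) (n : ℕ) :
    Integrable fun t : ℝ => t ^ n * (Real.exp (-s * t ^ 2) * |t| ^ (2 * c - 1)) := by
  refine Integrable.mono' (integrable_exp_mul_abs_rpow (b := c + n / 2) (by positivity) hs)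
    (by fun_prop) ?_
  filter_upwards [ae_ne_zero] with t ht
  rw [norm_mul, norm_mul, norm_pow, Real.norm_eq_abs, Real.norm_of_nonneg (Real.exp_pos _).le,
    Real.norm_of_nonneg (Real.rpow_nonneg (abs_nonneg t) _), ← abs_pow_mul_abs_rpow ht]
  exact le_of_eq (by ring)

lemma integral_sq_pow_mul {c s : ℝ} (hc : 0 < c) (hs : 0 < s) (q : ℕ) :
    ∫ t : ℝ, (t ^ 2) ^ q * (Real.exp (-s * t ^ 2) * |t| ^ (2 * c - 1)) =
      s ^ (-(c + q)) * (poch c q * Real.Gamma c) := by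
  rw [← Gamma_add_natCast hc, ← integral_exp_mul_abs_rpow (by positivity) hs]
  refine integral_congr_ae ?_
  filter_upwards [ae_ne_zero] with t ht
  have := abs_pow_mul_abs_rpow ht c (2 * q)
  rw [show c + ((2 * q : ℕ) : ℝ) / 2 = c + q by push_cast; ring] at this
  rw [← this, pow_mul, sq_abs]
  ring

lemma integrable_sq_pow_mul {c s : ℝ} (hc : 0 < c) (hs : 0 < s) (q : ℕ) :
    Integrable fun t : ℝ => (t ^ 2) ^ q * (Real.exp (-s * t ^ 2) * |t| ^ (2 * c - 1)) := by
  simpa only [pow_mul] using integrable_pow_mul_exp_mul_abs_rpow hc hs (2 * q)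

lemma sum_choose_mul_neg_one_pow_mul_choose (m l : ℕ) :
    ∑ i ∈ Finset.range (m + 1), (m.choose i : ℝ) * (-1) ^ i * (i.choose l : ℝ) =
      if l = m then (-1) ^ m else 0 := by
  rw [sum_choose_mul_choose_mul_pow]
  split_ifs with h
  · simp [h]
  · rcases lt_or_ge m l with h' | h'
    · simp [Nat.choose_eq_zero_of_lt h']
    · rw [show (1 + -1 : ℝ) = 0 by ring, zero_pow (by omega), mul_zero]

/-- Up to sign, an `m`-th finite difference of `i ↦ (c + i)_q`. Chu–Vandermonde expands this
polynomial in the basis `C(i, l)`, and the difference at `0` isolates `l = m`; in particular it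
vanishes for `q < m`. -/
lemma sum_choose_mul_poch {c : ℝ} (hc : 0 < c) (m q : ℕ) :
    ∑ i ∈ Finset.range (m + 1), (m.choose i : ℝ) * (-1) ^ i * poch (c + i) q =
      poch c q * ((q.choose m : ℝ) * (m.factorial / poch c m) * (-1) ^ m) := by
  simp_rw [poch_add_div_poch hc, Finset.mul_sum]
  rw [Finset.sum_comm]
  have : ∀ l, ∑ i ∈ Finset.range (m + 1), (m.choose i : ℝ) * (-1) ^ i *
      (poch c q * ((q.choose l : ℝ) * ((i.choose l : ℝ) * (l.factorial / poch c l)))) =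
      if l = m then poch c q * ((q.choose m : ℝ) * (m.factorial / poch c m) * (-1) ^ m) else 0 := by
    intro l
    rw [Finset.sum_congr rfl (g := fun i => (m.choose i : ℝ) * (-1) ^ i * (i.choose l : ℝ) *
      (poch c q * ((q.choose l : ℝ) * (l.factorial / poch c l)))) fun i _ => by ring,
      ← Finset.sum_mul, sum_choose_mul_neg_one_pow_mul_choose]
    split_ifs with h
    · rw [h]; ring
    · simp
  simp_rw [this]
  rw [Finset.sum_ite_eq']
  split_ifs with h
  · rfl
  · rw [Nat.choose_eq_zero_of_lt (by simpa using h)]; simp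

lemma integrable_confluentPoly_mul {c s : ℝ} (hc : 0 < c) (hs : 0 < s) (m q : ℕ) :
    Integrable fun t : ℝ => confluentPoly m c (t ^ 2) * ((t ^ 2) ^ q *
      (Real.exp (-s * t ^ 2) * |t| ^ (2 * c - 1))) := by
  simp_rw [confluentPoly_eq_sum m hc, Finset.sum_mul]
  refine integrable_finsetSum _ fun i _ => ?_
  refine ((integrable_sq_pow_mul hc hs (i + q)).const_mul
    ((m.choose i : ℝ) * ((-1) ^ i / poch c i))).congr (Filter.Eventually.of_forall fun t => ?_)
  simp only [neg_pow (t ^ 2) i, pow_add]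
  ring

/-- The moment `(c)_{i+q} Γ(c)` cancels the denominator `(c)_i`, leaving the finite difference of
`(c + i)_q`. -/
lemma integral_confluentPoly_mul_sq_pow {c : ℝ} (hc : 0 < c) (m q : ℕ) :
    ∫ t : ℝ, confluentPoly m c (t ^ 2) * ((t ^ 2) ^ q *
      (Real.exp (-1 * t ^ 2) * |t| ^ (2 * c - 1))) =
      Real.Gamma c * (poch c q * ((q.choose m : ℝ) * (m.factorial / poch c m) * (-1) ^ m)) := by
  rw [← sum_choose_mul_poch hc, Finset.mul_sum]
  have h : ∀ t : ℝ, confluentPoly m c (t ^ 2) * ((t ^ 2) ^ q *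
      (Real.exp (-1 * t ^ 2) * |t| ^ (2 * c - 1))) = ∑ i ∈ Finset.range (m + 1),
      (m.choose i : ℝ) * ((-1) ^ i / poch c i) * ((t ^ 2) ^ (i + q) *
      (Real.exp (-1 * t ^ 2) * |t| ^ (2 * c - 1))) := fun t => by
    rw [confluentPoly_eq_sum m hc, Finset.sum_mul]
    refine Finset.sum_congr rfl fun i _ => ?_
    rw [neg_pow (t ^ 2) i, pow_add]
    ring
  simp_rw [h]
  rw [integral_finsetSum _ fun i _ => (integrable_sq_pow_mul hc one_pos (i + q)).const_mul _]
  refine Finset.sum_congr rfl fun i _ => ?_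
  rw [integral_const_mul, integral_sq_pow_mul hc one_pos, poch_add, Real.one_rpow]
  have := poch_ne_zero hc i
  field_simp

lemma integral_confluentPoly_mul_confluentPoly {c : ℝ} (hc : 0 < c) (m n : ℕ) :
    ∫ t : ℝ, confluentPoly m c (t ^ 2) * (confluentPoly n c (t ^ 2) *
      (Real.exp (-1 * t ^ 2) * |t| ^ (2 * c - 1))) =
      if m = n then Real.Gamma c * (m.factorial / poch c m) else 0 := by
  have h : ∀ t : ℝ, confluentPoly m c (t ^ 2) * (confluentPoly n c (t ^ 2) *
      (Real.exp (-1 * t ^ 2) * |t| ^ (2 * c - 1))) = ∑ q ∈ Finset.range (n + 1),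
      (n.choose q : ℝ) * ((-1) ^ q / poch c q) * (confluentPoly m c (t ^ 2) * ((t ^ 2) ^ q *
      (Real.exp (-1 * t ^ 2) * |t| ^ (2 * c - 1)))) := fun t => by
    rw [confluentPoly_eq_sum n hc, Finset.sum_mul, Finset.mul_sum]
    refine Finset.sum_congr rfl fun i _ => ?_
    rw [neg_pow (t ^ 2) i]
    ring
  simp_rw [h]
  rw [integral_finsetSum _ fun i _ => (integrable_confluentPoly_mul hc one_pos m i).const_mul _]
  simp_rw [integral_const_mul, integral_confluentPoly_mul_sq_pow hc]
  rw [Finset.sum_congr rfl (g := fun q => (n.choose q : ℝ) * (-1) ^ q * (q.choose m : ℝ) *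
      (Real.Gamma c * (m.factorial / poch c m) * (-1) ^ m)) fun q _ => by
    have := poch_ne_zero hc q
    field_simp, ← Finset.sum_mul, sum_choose_mul_neg_one_pow_mul_choose]
  split_ifs with h
  · have h1 : ((-1 : ℝ) ^ n) * (-1) ^ n = 1 := by rw [← mul_pow]; simp
    rw [h]
    linear_combination Real.Gamma c * (n.factorial / poch c n) * h1
  · simp

lemma integrable_confluentPoly_mul_confluentPoly {c : ℝ} (hc : 0 < c) (m n : ℕ) :
    Integrable fun t : ℝ => confluentPoly m c (t ^ 2) * (confluentPoly n c (t ^ 2) *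
      (Real.exp (-1 * t ^ 2) * |t| ^ (2 * c - 1))) := by
  simp_rw [confluentPoly_eq_sum n hc, Finset.sum_mul, Finset.mul_sum]
  refine integrable_finsetSum _ fun q _ => ?_
  refine ((integrable_confluentPoly_mul hc one_pos m q).const_mul
    ((n.choose q : ℝ) * ((-1) ^ q / poch c q))).congr (Filter.Eventually.of_forall fun t => ?_)
  simp only [neg_pow (t ^ 2) q]
  ring

lemma laguerreFun_mul_laguerreFun (c : ℝ) (m n : ℕ) (t : ℝ) :
    laguerreFun c m t * laguerreFun c n t * |t| ^ (2 * c - 1) =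
      (-1) ^ m * √(poch c m / (m.factorial * Real.Gamma c)) *
      ((-1) ^ n * √(poch c n / (n.factorial * Real.Gamma c))) *
      (confluentPoly m c (t ^ 2) * (confluentPoly n c (t ^ 2) *
      (Real.exp (-1 * t ^ 2) * |t| ^ (2 * c - 1)))) := by
  rw [show -1 * t ^ 2 = -(1 / 2) * t ^ 2 + -(1 / 2) * t ^ 2 by ring, Real.exp_add, laguerreFun,
    laguerreFun]
  ring

lemma integrable_laguerreFun_mul_laguerreFun {c : ℝ} (hc : 0 < c) (m n : ℕ) :
    Integrable fun t : ℝ => laguerreFun c m t * laguerreFun c n t * |t| ^ (2 * c - 1) := by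
  simp_rw [laguerreFun_mul_laguerreFun]
  exact (integrable_confluentPoly_mul_confluentPoly hc m n).const_mul _

lemma integral_laguerreFun_mul_laguerreFun {c : ℝ} (hc : 0 < c) (m n : ℕ) :
    ∫ t : ℝ, laguerreFun c m t * laguerreFun c n t * |t| ^ (2 * c - 1) =
      if m = n then 1 else 0 := by
  simp_rw [laguerreFun_mul_laguerreFun]
  rw [integral_const_mul, integral_confluentPoly_mul_confluentPoly hc]
  split_ifs with h
  · subst h
    have hp := poch_pos hc m
    have hG := Real.Gamma_pos_of_pos hc
    have h1 : ((-1 : ℝ) ^ m) * (-1) ^ m = 1 := by rw [← mul_pow]; simp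
    have h2 : √(poch c m / (m.factorial * Real.Gamma c)) *
        √(poch c m / (m.factorial * Real.Gamma c)) = poch c m / (m.factorial * Real.Gamma c) :=
      Real.mul_self_sqrt (by positivity)
    generalize √(poch c m / (m.factorial * Real.Gamma c)) = S at *
    have h3 : poch c m / (m.factorial * Real.Gamma c) *
        (Real.Gamma c * (m.factorial / poch c m)) = 1 := by field_simp
    rw [← h2] at h3
    linear_combination S * S * (Real.Gamma c * (m.factorial / poch c m)) * h1 + h3
  · simp

/-! ### Laguerre functions under the Hankel transform. -/

lemma hasSum_choose_mul_pow_div_factorial (l : ℕ) (s : ℝ) :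
    HasSum (fun q : ℕ => (q.choose l : ℝ) * l.factorial * (s ^ q / q.factorial))
      (s ^ l * Real.exp s) := by
  have hexp : HasSum (fun k : ℕ => s ^ k / (k.factorial : ℝ)) (Real.exp s) := by
    rw [Real.exp_eq_exp_ℝ]; exact NormedSpace.expSeries_div_hasSum_exp s
  refine ((add_right_injective l).hasSum_iff fun q hq => ?_).mp ?_
  · have : q < l := by
      by_contra h
      exact hq ⟨q - l, by simp; omega⟩
    rw [Nat.choose_eq_zero_of_lt this]; simp
  · refine (congrArg (HasSum · _) (funext fun d => ?_)).mpr (hexp.mul_left (s ^ l))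
    have := (l + d).factorial_ne_zero
    simp only [Function.comp_apply]
    rw [Nat.cast_choose ℝ (Nat.le_add_right l d), Nat.add_sub_cancel_left, pow_add]
    field_simp

/-- Kummer's first transformation, for the numerator parameter `c + i`. -/
lemma hasSum_poch_add_div_poch {c : ℝ} (hc : 0 < c) (i : ℕ) (s : ℝ) :
    HasSum (fun q : ℕ => poch (c + i) q / poch c q * (s ^ q / q.factorial))
      (Real.exp s * confluentPoly i c (-s)) := by
  have h := hasSum_sum (s := Finset.range (i + 1)) fun l _ =>
    (hasSum_choose_mul_pow_div_factorial l s).mul_left ((i.choose l : ℝ) / poch c l)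
  have hval : ∑ l ∈ Finset.range (i + 1), (i.choose l : ℝ) / poch c l * (s ^ l * Real.exp s) =
      Real.exp s * confluentPoly i c (-s) := by
    rw [confluentPoly_eq_sum i hc, Finset.mul_sum, neg_neg]
    exact Finset.sum_congr rfl fun l _ => by ring
  rw [hval] at h
  refine (congrArg (HasSum · _) (funext fun q => ?_)).mpr h
  rw [poch_add_div_poch hc, mul_div_cancel_left₀ _ (poch_ne_zero hc q), Finset.sum_mul]
  -- Chu–Vandermonde sums over `l ≤ q`, the polynomial over `l ≤ i`. Both extend to `max q i`, the
  -- added terms being zero.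
  have hext : ∀ r n : ℕ, r ≤ n → (∀ l, r < l → (i.choose l : ℝ) * (q.choose l : ℝ) = 0) →
      ∑ l ∈ Finset.range (r + 1), (q.choose l : ℝ) * ((i.choose l : ℝ) *
        (l.factorial / poch c l)) * (s ^ q / q.factorial) =
      ∑ l ∈ Finset.range (n + 1), (i.choose l : ℝ) / poch c l *
        ((q.choose l : ℝ) * l.factorial * (s ^ q / q.factorial)) := by
    intro r n hrn hz
    rw [Finset.sum_subset (s₂ := Finset.range (n + 1)) (by intro; simp; omega)]
    · exact Finset.sum_congr rfl fun l _ => by ring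
    · intro l _ hl
      linear_combination (l.factorial / poch c l) * (s ^ q / q.factorial) *
        hz l (by simpa using hl)
  rw [hext q (max q i) (le_max_left _ _) fun l hl => by rw [Nat.choose_eq_zero_of_lt hl]; simp]
  refine (Finset.sum_subset (by intro; simp; omega) fun l _ hl => ?_).symm
  rw [Nat.choose_eq_zero_of_lt (n := i) (by simpa using hl)]; simp

/-- The restriction of the Bessel series to the real line. -/
def besselSeriesReal (c s : ℝ) : ℝ := ∑' k : ℕ, s ^ k / (k.factorial * poch c k)

lemma besselSeries_ofReal (c s : ℝ) : besselSeries c s = (besselSeriesReal c s : ℂ) := by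
  rw [besselSeries, besselSeriesReal, Complex.ofReal_tsum]
  push_cast
  rfl

/-- Termwise integration gives a Kummer series with numerator parameter `c + i`, summed by Kummer's
first transformation. The same series at `|κ|` justifies the interchange. -/
lemma integral_besselSeriesReal_mul_sq_pow {c : ℝ} (hc : 0 < c) (κ : ℝ) (i : ℕ) :
    Integrable (fun t : ℝ => besselSeriesReal c (κ * t ^ 2 / 4) *
      ((t ^ 2) ^ i * (Real.exp (-(1 / 2) * t ^ 2) * |t| ^ (2 * c - 1)))) ∧
    ∫ t : ℝ, besselSeriesReal c (κ * t ^ 2 / 4) *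
      ((t ^ 2) ^ i * (Real.exp (-(1 / 2) * t ^ 2) * |t| ^ (2 * c - 1))) =
      2 ^ c * Real.Gamma c * (2 ^ i * poch c i) *
        (Real.exp (κ / 2) * confluentPoly i c (-(κ / 2))) := by
  have hh : (0 : ℝ) < 1 / 2 := by norm_num
  set G : ℝ → ℝ := fun t => Real.exp (-(1 / 2) * t ^ 2) * |t| ^ (2 * c - 1) with hG
  have hG0 : ∀ t, 0 ≤ G t := fun t => by positivity
  set F : ℕ → ℝ → ℝ := fun q t =>
    (κ * t ^ 2 / 4) ^ q / (q.factorial * poch c q) * ((t ^ 2) ^ i * G t) with hF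
  have hFeq : ∀ q t, F q t =
      (κ / 4) ^ q / (q.factorial * poch c q) * ((t ^ 2) ^ (i + q) * G t) := fun q t => by
    simp only [hF]
    rw [show κ * t ^ 2 / 4 = κ / 4 * t ^ 2 by ring, mul_pow, pow_add]
    ring
  have hFint : ∀ q, Integrable (F q) := fun q => by
    simp_rw [funext (hFeq q)]
    exact (integrable_sq_pow_mul hc hh (i + q)).const_mul _
  have hmom : ∀ (r : ℝ) (q : ℕ), r ^ q / (q.factorial * poch c q) *
      ∫ t, (t ^ 2) ^ (i + q) * G t =
      2 ^ c * Real.Gamma c * (2 ^ i * poch c i) *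
        (poch (c + i) q / poch c q * ((2 * r) ^ q / q.factorial)) := fun r q => by
    rw [integral_sq_pow_mul hc hh, poch_add, Real.rpow_neg hh.le, ← Real.inv_rpow hh.le,
      Real.rpow_add (by norm_num), Real.rpow_natCast, mul_pow, pow_add]
    rw [show ((1 : ℝ) / 2)⁻¹ = 2 by norm_num]
    have := poch_ne_zero hc q
    field_simp
  have hval : ∀ q, ∫ t, F q t = 2 ^ c * Real.Gamma c * (2 ^ i * poch c i) *
        (poch (c + i) q / poch c q * ((κ / 2) ^ q / q.factorial)) := fun q => by
    simp_rw [hFeq q]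
    rw [integral_const_mul, hmom]
    congr 4
    ring
  have hnorm : ∀ q, ∫ t, ‖F q t‖ = 2 ^ c * Real.Gamma c * (2 ^ i * poch c i) *
        (poch (c + i) q / poch c q * ((|κ| / 2) ^ q / q.factorial)) := fun q => by
    have : ∀ t, ‖F q t‖ =
        (|κ| / 4) ^ q / (q.factorial * poch c q) * ((t ^ 2) ^ (i + q) * G t) := fun t => by
      have hp := poch_pos hc q
      rw [hFeq, norm_mul, norm_div, norm_pow,
        Real.norm_of_nonneg (mul_nonneg (by positivity) (hG0 t)),
        Real.norm_of_nonneg (by positivity : (0 : ℝ) ≤ q.factorial * poch c q), norm_div,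
        Real.norm_eq_abs, Real.norm_of_nonneg (by norm_num : (0 : ℝ) ≤ 4)]
    simp_rw [this]
    rw [integral_const_mul, hmom]
    congr 4
    ring
  have hsum : Summable fun q => ∫ t, ‖F q t‖ := by
    simp_rw [hnorm]
    exact (hasSum_poch_add_div_poch hc i _).summable.mul_left _
  have htsum : ∀ t, ∑' q, F q t = besselSeriesReal c (κ * t ^ 2 / 4) *
      ((t ^ 2) ^ i * G t) := fun t => tsum_mul_right
  have hint := integrable_tsum_of_summable_integral_norm hFint hsum fun t =>
    (summable_besselSeries_real hc _).mul_right _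
  have hs := hasSum_integral_of_summable_integral_norm hFint hsum
  simp_rw [htsum] at hint hs
  refine ⟨hint, ?_⟩
  simp_rw [hval] at hs
  have h2 := (hasSum_poch_add_div_poch hc i (κ / 2)).mul_left
    (2 ^ c * Real.Gamma c * (2 ^ i * poch c i))
  exact hs.unique h2

/-- The Laguerre functions are eigenfunctions of the Hankel transform. -/
lemma integral_besselSeriesReal_mul_laguerreFun {c : ℝ} (hc : 0 < c) (x : ℝ) (m : ℕ) :
    Integrable (fun t : ℝ => besselSeriesReal c (-(x ^ 2 * t ^ 2) / 4) *
      (laguerreFun c m t * |t| ^ (2 * c - 1))) ∧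
    ∫ t : ℝ, besselSeriesReal c (-(x ^ 2 * t ^ 2) / 4) *
      (laguerreFun c m t * |t| ^ (2 * c - 1)) =
      2 ^ c * Real.Gamma c * ((-1) ^ m * laguerreFun c m x) := by
  set a : ℝ := (-1) ^ m * √(poch c m / (m.factorial * Real.Gamma c)) with ha
  set H : ℕ → ℝ → ℝ := fun i t => besselSeriesReal c (-(x ^ 2 * t ^ 2) / 4) *
      ((t ^ 2) ^ i * (Real.exp (-(1 / 2) * t ^ 2) * |t| ^ (2 * c - 1)))
  have heq : ∀ t, besselSeriesReal c (-(x ^ 2 * t ^ 2) / 4) *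
      (laguerreFun c m t * |t| ^ (2 * c - 1)) = ∑ i ∈ Finset.range (m + 1),
      (a * ((m.choose i : ℝ) * ((-1) ^ i / poch c i))) * H i t := fun t => by
    rw [laguerreFun, ← ha, confluentPoly_eq_sum m hc, Finset.mul_sum, Finset.mul_sum,
      Finset.sum_mul, Finset.mul_sum]
    refine Finset.sum_congr rfl fun i _ => ?_
    simp only [H]
    rw [neg_pow (t ^ 2) i]
    ring
  have hκ : ∀ t : ℝ, -x ^ 2 * t ^ 2 / 4 = -(x ^ 2 * t ^ 2) / 4 := fun t => by ring
  have hH : ∀ i, Integrable (H i) := fun i => by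
    have h := (integral_besselSeriesReal_mul_sq_pow hc (-x ^ 2) i).1
    simp only [hκ] at h
    exact h
  have hHv : ∀ i, ∫ t, H i t = 2 ^ c * Real.Gamma c * (2 ^ i * poch c i) *
      (Real.exp (-(1 / 2) * x ^ 2) * confluentPoly i c (x ^ 2 / 2)) := fun i => by
    have h := (integral_besselSeriesReal_mul_sq_pow hc (-x ^ 2) i).2
    simp only [hκ] at h
    rw [show -x ^ 2 / 2 = -(1 / 2) * x ^ 2 by ring, show -(-(1 / 2) * x ^ 2) = x ^ 2 / 2 by ring]
      at h
    exact h
  simp_rw [heq]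
  refine ⟨integrable_finsetSum _ fun i _ => (hH i).const_mul _, ?_⟩
  rw [integral_finsetSum _ fun i _ => (hH i).const_mul _]
  simp_rw [integral_const_mul, hHv]
  -- The ratio `-2` combines the sign of the `i`-th coefficient with the `2^i` from the moments. It
  -- turns the argument `x²/2` back into `x²` and produces the eigenvalue `(-1)^m`.
  have hb := sum_choose_mul_pow_mul_confluentPoly hc m (-2) (x ^ 2 / 2)
  have hr : ∑ l ∈ Finset.range (m + 1), (m.choose l : ℝ) * (-2) ^ l * (1 + -2) ^ (m - l) *
      ((-(x ^ 2 / 2)) ^ l / poch c l) = (-1) ^ m * confluentPoly m c (x ^ 2) := by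
    rw [confluentPoly_eq_sum m hc, Finset.mul_sum]
    refine Finset.sum_congr rfl fun l hl => ?_
    obtain ⟨d, rfl⟩ := Nat.exists_eq_add_of_le (show l ≤ m by have := Finset.mem_range.mp hl; omega)
    have h1 : (-2 : ℝ) ^ l * (-(x ^ 2 / 2)) ^ l = (-1) ^ l * (-x ^ 2) ^ l := by
      rw [← mul_pow, ← mul_pow]; congr 1; ring
    rw [Nat.add_sub_cancel_left, pow_add, show (1 + -2 : ℝ) = -1 by norm_num]
    linear_combination ((l + d).choose l : ℝ) * (-1) ^ d / poch c l * h1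
  rw [hr] at hb
  rw [laguerreFun, ← ha, show 2 ^ c * Real.Gamma c * ((-1) ^ m * (a *
    (Real.exp (-(1 / 2) * x ^ 2) * confluentPoly m c (x ^ 2)))) =
    2 ^ c * Real.Gamma c * a * Real.exp (-(1 / 2) * x ^ 2) *
      ((-1) ^ m * confluentPoly m c (x ^ 2)) by ring, ← hb, Finset.mul_sum]
  refine Finset.sum_congr rfl fun i _ => ?_
  have := poch_ne_zero hc i
  rw [neg_pow (2 : ℝ) i]
  field_simp

/-! ### The generalized Fourier transform of the Hermite functions. -/

lemma poch_le_poch {c d : ℝ} (hc : 0 < c) (hcd : c ≤ d) (k : ℕ) : poch c k ≤ poch d k := by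
  induction k with
  | zero => simp
  | succ k ih =>
    rw [poch_succ, poch_succ]
    have := (poch_pos (hc.trans_le hcd) k).le
    gcongr

lemma measurable_besselSeriesReal {c : ℝ} (hc : 0 < c) : Measurable (besselSeriesReal c) := by
  refine measurable_of_tendsto_metrizable
    (f := fun n s => ∑ k ∈ Finset.range n, s ^ k / (k.factorial * poch c k))
    (fun n => by fun_prop) ?_
  rw [tendsto_pi_nhds]
  exact fun s => (summable_besselSeries_real hc s).hasSum.tendsto_sum_nat

lemma abs_besselSeriesReal_le {c d : ℝ} (hc : 0 < c) (hcd : c ≤ d) (s : ℝ) :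
    |besselSeriesReal d s| ≤ besselSeriesReal c |s| := by
  have hd := hc.trans_le hcd
  rw [← Real.norm_eq_abs (besselSeriesReal d s), besselSeriesReal]
  refine tsum_of_norm_bounded (summable_besselSeries_real hc |s|).hasSum fun k => ?_
  have := poch_pos hc k
  have := poch_pos hd k
  have := poch_le_poch hc hcd k
  rw [norm_div, norm_pow, Real.norm_eq_abs,
    Real.norm_of_nonneg (by positivity : (0 : ℝ) ≤ k.factorial * poch d k)]
  gcongr

/-- Needed to split the Fourier integral, although this odd part contributes `0`. The bounds `|t| ≤
1 + t²` and `abs_besselSeriesReal_le` reduce it to the even integrals at `|κ|`. -/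
lemma integrable_mul_besselSeriesReal_mul_sq_pow {c d : ℝ} (hc : 0 < c) (hcd : c ≤ d) (κ : ℝ)
    (i : ℕ) :
    Integrable (fun t : ℝ => t * besselSeriesReal d (κ * t ^ 2 / 4) *
      ((t ^ 2) ^ i * (Real.exp (-(1 / 2) * t ^ 2) * |t| ^ (2 * c - 1)))) := by
  refine Integrable.mono' ((integral_besselSeriesReal_mul_sq_pow hc |κ| i).1.add
    (integral_besselSeriesReal_mul_sq_pow hc |κ| (i + 1)).1) ?_
    (Filter.Eventually.of_forall fun t => ?_)
  · have := (measurable_besselSeriesReal (hc.trans_le hcd)).comp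
      (by fun_prop : Measurable fun t : ℝ => κ * t ^ 2 / 4)
    exact ((measurable_id.mul this).mul (by fun_prop)).aestronglyMeasurable
  · have hG : 0 ≤ (t ^ 2) ^ i * (Real.exp (-(1 / 2) * t ^ 2) * |t| ^ (2 * c - 1)) := by positivity
    have hb := abs_besselSeriesReal_le hc hcd (κ * t ^ 2 / 4)
    rw [abs_div, abs_mul, abs_of_nonneg (sq_nonneg t), abs_of_pos (by norm_num : (0 : ℝ) < 4)] at hb
    have ht : |t| ≤ 1 + t ^ 2 := by
      rw [← sq_abs]; nlinarith [sq_nonneg (|t| - 1), abs_nonneg t]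
    simp only [Pi.add_apply]
    rw [norm_mul, norm_mul, Real.norm_eq_abs, Real.norm_eq_abs, Real.norm_of_nonneg hG]
    calc _ ≤ (1 + t ^ 2) * besselSeriesReal c (|κ| * t ^ 2 / 4) * _ := by gcongr
      _ = _ := by ring

lemma integrable_mul_besselSeriesReal_mul_laguerreFun {c d e : ℝ} (hc : 0 < c) (hcd : c ≤ d)
    (he : 0 < e) (x : ℝ) (m : ℕ) :
    Integrable (fun t : ℝ => t * besselSeriesReal d (-(x ^ 2 * t ^ 2) / 4) *
      (laguerreFun e m t * |t| ^ (2 * c - 1))) := by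
  set a : ℝ := (-1) ^ m * √(poch e m / (m.factorial * Real.Gamma e)) with ha
  have heq : ∀ t, t * besselSeriesReal d (-(x ^ 2 * t ^ 2) / 4) *
      (laguerreFun e m t * |t| ^ (2 * c - 1)) = ∑ i ∈ Finset.range (m + 1),
      (a * ((m.choose i : ℝ) * ((-1) ^ i / poch e i))) *
      (t * besselSeriesReal d (-x ^ 2 * t ^ 2 / 4) *
      ((t ^ 2) ^ i * (Real.exp (-(1 / 2) * t ^ 2) * |t| ^ (2 * c - 1)))) := fun t => by
    rw [laguerreFun, ← ha, confluentPoly_eq_sum m he, Finset.mul_sum, Finset.mul_sum,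
      Finset.sum_mul, Finset.mul_sum]
    refine Finset.sum_congr rfl fun i _ => ?_
    rw [neg_pow (t ^ 2) i, ← neg_mul]
    ring
  simp_rw [heq]
  exact integrable_finsetSum _ fun i _ =>
    (integrable_mul_besselSeriesReal_mul_sq_pow hc hcd _ i).const_mul _

lemma laguerreFun_neg (c : ℝ) (m : ℕ) (t : ℝ) : laguerreFun c m (-t) = laguerreFun c m t := by
  simp [laguerreFun]

lemma sq_mul_abs_rpow {c : ℝ} (hc : 0 < c) (t : ℝ) :
    t ^ 2 * |t| ^ (2 * c - 1) = |t| ^ (2 * (c + 1) - 1) := by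
  rcases eq_or_ne t 0 with rfl | ht
  · rw [abs_zero, Real.zero_rpow (x := 2 * (c + 1) - 1) (by linarith)]; simp
  · have := abs_pow_mul_abs_rpow ht c 2
    rw [sq_abs] at this
    rw [this]
    norm_num

lemma expMu_neg_I_mul {μ : ℝ} (hμ : -(1 / 2) < μ) (x t : ℝ) :
    expMu μ (-Complex.I * (x : ℂ) * (t : ℂ)) =
      (besselSeriesReal (μ + 1 / 2) (-(x ^ 2 * t ^ 2) / 4) : ℂ) +
      -Complex.I * x / (2 * μ + 1) *
        ((t * besselSeriesReal (μ + 3 / 2) (-(x ^ 2 * t ^ 2) / 4) : ℝ) : ℂ) := by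
  have h : (-Complex.I * (x : ℂ) * (t : ℂ)) ^ 2 / 4 = ((-(x ^ 2 * t ^ 2) / 4 : ℝ) : ℂ) := by
    push_cast
    rw [mul_pow, mul_pow, neg_sq, Complex.I_sq]
    ring
  rw [expMu_eq hμ, h, besselSeries_ofReal, besselSeries_ofReal]
  push_cast
  ring

lemma integral_ofReal_add_mul {f g : ℝ → ℝ} (hf : Integrable f) (hg : Integrable g) (k : ℂ) :
    Integrable (fun t => (f t : ℂ) + k * (g t : ℂ)) ∧
    ∫ t, ((f t : ℂ) + k * (g t : ℂ)) = ((∫ t, f t : ℝ) : ℂ) + k * ((∫ t, g t : ℝ) : ℂ) := by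
  have hf' : Integrable fun t => (f t : ℂ) := hf.ofReal
  have hg' : Integrable fun t => k * (g t : ℂ) := hg.ofReal.const_mul k
  exact ⟨hf'.add hg', by
    rw [integral_add hf' hg', integral_const_mul, integral_complex_ofReal,
      integral_complex_ofReal]⟩

/-- Parity kills one half of the kernel; the other half is a Hankel transform with parameter `μ +
1/2` or `μ + 3/2`. In odd degree the factor `1/(2μ + 1)` is absorbed by `2^(μ+3/2) Γ(μ+3/2) = (2μ+1)
2^(μ+1/2) Γ(μ+1/2)`. -/
lemma fourierMu_hermiteFun {μ : ℝ} (hμ : -(1 / 2) < μ) (n : ℕ) (x : ℝ) :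
    Integrable (fourierIntegrand μ (fun t : ℝ => (hermiteFun μ n t : ℂ)) x) ∧
    fourierMu μ (fun t : ℝ => (hermiteFun μ n t : ℂ)) x =
      (-Complex.I) ^ n * (hermiteFun μ n x : ℂ) := by
  have hc : 0 < μ + 1 / 2 := by linarith
  have hc' : 0 < μ + 3 / 2 := by linarith
  have hne : (2 * μ + 1 : ℂ) ≠ 0 := by
    have : 2 * μ + 1 ≠ 0 := by linarith
    exact_mod_cast this
  have hG := Real.Gamma_pos_of_pos hc
  have hw : 2 * μ = 2 * (μ + 1 / 2) - 1 := by ring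
  have hκ : (((2 : ℝ) ^ (μ + 1 / 2) * Real.Gamma (μ + 1 / 2) : ℝ) : ℂ) ≠ 0 := by
    exact_mod_cast (by positivity : (2 : ℝ) ^ (μ + 1 / 2) * Real.Gamma (μ + 1 / 2) ≠ 0)
  obtain ⟨m, rfl | rfl⟩ := n.even_or_odd'
  · obtain ⟨h1, h1v⟩ := integral_besselSeriesReal_mul_laguerreFun hc x m
    have h2 := integrable_mul_besselSeriesReal_mul_laguerreFun (d := μ + 3 / 2) hc (by linarith)
      hc x m
    have h2v : ∫ t : ℝ, t * besselSeriesReal (μ + 3 / 2) (-(x ^ 2 * t ^ 2) / 4) *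
        (laguerreFun (μ + 1 / 2) m t * |t| ^ (2 * (μ + 1 / 2) - 1)) = 0 :=
      integral_eq_zero_of_odd fun t => by rw [laguerreFun_neg, abs_neg, neg_sq]; ring
    have heq : fourierIntegrand μ (fun t : ℝ => (hermiteFun μ (2 * m) t : ℂ)) x = fun t =>
        ((besselSeriesReal (μ + 1 / 2) (-(x ^ 2 * t ^ 2) / 4) *
          (laguerreFun (μ + 1 / 2) m t * |t| ^ (2 * (μ + 1 / 2) - 1)) : ℝ) : ℂ) +
        -Complex.I * x / (2 * μ + 1) *
        ((t * besselSeriesReal (μ + 3 / 2) (-(x ^ 2 * t ^ 2) / 4) *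
          (laguerreFun (μ + 1 / 2) m t * |t| ^ (2 * (μ + 1 / 2) - 1)) : ℝ) : ℂ) := by
      funext t
      rw [fourierIntegrand, expMu_neg_I_mul hμ, hermiteFun_two_mul hμ, ← hw]
      push_cast
      ring
    obtain ⟨hi, hv⟩ := integral_ofReal_add_mul h1 h2 (-Complex.I * x / (2 * μ + 1))
    refine ⟨by rw [heq]; exact hi, ?_⟩
    rw [fourierMu, heq, hv, h2v, h1v, hermiteFun_two_mul hμ, pow_mul, neg_sq, Complex.I_sq]
    rw [Complex.ofReal_mul _ ((-1) ^ m * _), Complex.ofReal_zero, mul_zero, add_zero,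
      inv_mul_cancel_left₀ hκ]
    push_cast
    ring
  · obtain ⟨h1, h1v⟩ := integral_besselSeriesReal_mul_laguerreFun hc' x m
    have h2 := integrable_mul_besselSeriesReal_mul_laguerreFun hc le_rfl hc' x m
    have h2v : ∫ t : ℝ, t * besselSeriesReal (μ + 1 / 2) (-(x ^ 2 * t ^ 2) / 4) *
        (laguerreFun (μ + 3 / 2) m t * |t| ^ (2 * (μ + 1 / 2) - 1)) = 0 :=
      integral_eq_zero_of_odd fun t => by rw [laguerreFun_neg, abs_neg, neg_sq]; ring
    have heq : fourierIntegrand μ (fun t : ℝ => (hermiteFun μ (2 * m + 1) t : ℂ)) x = fun t =>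
        ((t * besselSeriesReal (μ + 1 / 2) (-(x ^ 2 * t ^ 2) / 4) *
          (laguerreFun (μ + 3 / 2) m t * |t| ^ (2 * (μ + 1 / 2) - 1)) : ℝ) : ℂ) +
        -Complex.I * x / (2 * μ + 1) *
        ((besselSeriesReal (μ + 3 / 2) (-(x ^ 2 * t ^ 2) / 4) *
          (laguerreFun (μ + 3 / 2) m t * |t| ^ (2 * (μ + 3 / 2) - 1)) : ℝ) : ℂ) := by
      funext t
      rw [fourierIntegrand, expMu_neg_I_mul hμ, hermiteFun_two_mul_add_one hμ,
        show μ + 3 / 2 = μ + 1 / 2 + 1 by ring, ← sq_mul_abs_rpow hc, ← hw]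
      push_cast
      ring
    obtain ⟨hi, hv⟩ := integral_ofReal_add_mul h2 h1 (-Complex.I * x / (2 * μ + 1))
    refine ⟨by rw [heq]; exact hi, ?_⟩
    have hΓ : Real.Gamma (μ + 3 / 2) = (μ + 1 / 2) * Real.Gamma (μ + 1 / 2) := by
      rw [← Real.Gamma_add_one hc.ne']; congr 1; ring
    have h2p : (2 : ℝ) ^ (μ + 3 / 2) = 2 ^ (μ + 1 / 2) * 2 := by
      rw [show μ + 3 / 2 = μ + 1 / 2 + 1 by ring, Real.rpow_add two_pos, Real.rpow_one]
    rw [fourierMu, heq, hv, h2v, h1v, hermiteFun_two_mul_add_one hμ, pow_succ, pow_mul, neg_sq, Complex.I_sq, hΓ, h2p,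
      show (2 : ℝ) ^ (μ + 1 / 2) * 2 * ((μ + 1 / 2) * Real.Gamma (μ + 1 / 2)) *
        ((-1) ^ m * laguerreFun (μ + 3 / 2) m x) = (2 ^ (μ + 1 / 2) * Real.Gamma (μ + 1 / 2)) *
        ((2 * μ + 1) * ((-1) ^ m * laguerreFun (μ + 3 / 2) m x)) by ring]
    rw [Complex.ofReal_mul (2 ^ (μ + 1 / 2) * Real.Gamma (μ + 1 / 2)) ((2 * μ + 1) * _),
      Complex.ofReal_zero, zero_add, mul_left_comm, inv_mul_cancel_left₀ hκ]
    push_cast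
    field_simp

lemma exp_mul_pow_mem_fourierDomain (n : ℕ) :
    (fun x : ℝ => ((Real.exp (-(1 / 2) * x ^ 2) * x ^ n : ℝ) : ℂ)) ∈ fourierDomain :=
  Submodule.subset_span ⟨n, rfl⟩

lemma pow_mul_laguerreFun_mem_fourierDomain {c : ℝ} (hc : 0 < c) (m j : ℕ) :
    (fun x : ℝ => ((x ^ j * laguerreFun c m x : ℝ) : ℂ)) ∈ fourierDomain := by
  set a : ℝ := (-1) ^ m * √(poch c m / (m.factorial * Real.Gamma c)) with ha
  have heq : (fun x : ℝ => ((x ^ j * laguerreFun c m x : ℝ) : ℂ)) =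
      ∑ i ∈ Finset.range (m + 1), ((a * ((m.choose i : ℝ) * ((-1) ^ i / poch c i)) : ℝ) : ℂ) •
        fun x : ℝ => ((Real.exp (-(1 / 2) * x ^ 2) * x ^ (2 * i + j) : ℝ) : ℂ) := by
    funext x
    rw [Finset.sum_apply]
    simp only [Pi.smul_apply, smul_eq_mul]
    simp only [← Complex.ofReal_mul]
    rw [← Complex.ofReal_sum, laguerreFun, ← ha, confluentPoly_eq_sum m hc, Finset.mul_sum,
      Finset.mul_sum, Finset.mul_sum]
    congr 1
    refine Finset.sum_congr rfl fun i _ => ?_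
    rw [neg_pow (x ^ 2) i, pow_add, pow_mul]
    ring
  rw [heq]
  exact Submodule.sum_mem _ fun i _ => Submodule.smul_mem _ _ (exp_mul_pow_mem_fourierDomain _)

lemma hermiteFun_mem_fourierDomain {μ : ℝ} (hμ : -(1 / 2) < μ) (n : ℕ) :
    (fun x : ℝ => (hermiteFun μ n x : ℂ)) ∈ fourierDomain := by
  obtain ⟨m, rfl | rfl⟩ := n.even_or_odd'
  · simpa only [hermiteFun_two_mul hμ, pow_zero, one_mul] using
      pow_mul_laguerreFun_mem_fourierDomain (c := μ + 1 / 2) (by linarith) m 0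
  · simpa only [hermiteFun_two_mul_add_one hμ, pow_one] using
      pow_mul_laguerreFun_mem_fourierDomain (c := μ + 3 / 2) (by linarith) m 1

/-! ### Uniqueness from Fourier transforms and from moments. -/

open scoped FourierTransform SchwartzMap ContDiff in
/-- A function whose Fourier transform vanishes is zero almost everywhere. -/
lemma ae_eq_zero_of_fourier_eq_zero {ν : Measure ℝ} [SigmaFinite ν] {h : ℝ → ℂ}
    (hh : Integrable h ν) (hz : ∀ ξ : ℝ, ∫ t, Complex.exp (ξ * t * Complex.I) * h t ∂ν = 0) :
    ∀ᵐ t ∂ν, h t = 0 := by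
  refine ae_eq_zero_of_integral_contDiff_smul_eq_zero hh.locallyIntegrable fun g hg hgc => ?_
  have hg₁ : HasCompactSupport (Complex.ofRealCLM ∘ g) := hgc.comp_left rfl
  have hg₂ : ContDiff ℝ ∞ (Complex.ofRealCLM ∘ g) := by fun_prop
  set G : 𝓢(ℝ, ℂ) := hg₁.toSchwartzMap hg₂
  -- A test function is the Fourier transform of a Schwartz function, so Fubini moves the transform
  -- onto `h`, where it vanishes.
  have hflip := VectorFourier.integral_fourierIntegral_smul_eq_flip (L := innerₗ ℝ) (μ := ν)
    (ν := volume) (f := h) (g := (𝓕⁻ G : 𝓢(ℝ, ℂ)))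
    Real.continuous_fourierChar continuous_inner hh (𝓕⁻ G : 𝓢(ℝ, ℂ)).integrable
  have h0 : ∀ ξ, VectorFourier.fourierIntegral 𝐞 ν (innerₗ ℝ) h ξ = 0 := fun ξ => by
    rw [← hz (-(2 * Real.pi * ξ)), VectorFourier.fourierIntegral]
    refine integral_congr_ae (Filter.Eventually.of_forall fun t => ?_)
    simp only [Circle.smul_def, Real.fourierChar_apply, innerₗ_apply_apply, smul_eq_mul]
    congr 2
    simp
    ring
  have h1 : VectorFourier.fourierIntegral 𝐞 volume (innerₗ ℝ).flip (𝓕⁻ G : 𝓢(ℝ, ℂ)) =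
      fun x => (g x : ℂ) := by
    have : 𝓕 (𝓕⁻ G : 𝓢(ℝ, ℂ)) = G := FourierTransform.fourier_fourierInv_eq G
    have h2 := congrArg (fun F : 𝓢(ℝ, ℂ) => (F : ℝ → ℂ)) this
    simp only [SchwartzMap.fourier_coe] at h2
    rw [flip_innerₗ]
    exact h2
  simp only [h0, h1, zero_smul, integral_zero] at hflip
  rw [hflip]
  refine integral_congr_ae (Filter.Eventually.of_forall fun t => ?_)
  simp [mul_comm]

/-- A function with vanishing moments and exponential decay is zero almost everywhere. -/
lemma ae_eq_zero_of_moments_eq_zero {ν : Measure ℝ} [SigmaFinite ν] {h : ℝ → ℂ}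
    (hm : AEStronglyMeasurable h ν)
    (hexp : ∀ a : ℝ, Integrable (fun t => Real.exp (a * |t|) * ‖h t‖) ν)
    (hz : ∀ n : ℕ, ∫ t, (t : ℂ) ^ n * h t ∂ν = 0) : ∀ᵐ t ∂ν, h t = 0 := by
  have hh : Integrable h ν := by
    have := hexp 0
    simp only [zero_mul, Real.exp_zero, one_mul] at this
    exact (integrable_norm_iff hm).mp this
  refine ae_eq_zero_of_fourier_eq_zero hh fun ξ => ?_
  have hser : ∀ s : ℂ, HasSum (fun n : ℕ => s ^ n / (n.factorial : ℂ)) (Complex.exp s) :=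
    fun s => by rw [Complex.exp_eq_exp_ℂ]; exact NormedSpace.expSeries_div_hasSum_exp s
  have hbound : ∀ t : ℝ, ∑' n : ℕ, (|ξ| * |t|) ^ n / (n.factorial : ℝ) * ‖h t‖ =
      Real.exp (|ξ| * |t|) * ‖h t‖ := fun t => by
    rw [tsum_mul_right, Real.exp_eq_exp_ℝ, NormedSpace.exp_eq_tsum_div]
  set F : ℕ → ℝ → ℂ := fun n t => (ξ * t * Complex.I) ^ n / (n.factorial : ℂ) * h t with hF
  set bound : ℕ → ℝ → ℝ := fun n t => (|ξ| * |t|) ^ n / n.factorial * ‖h t‖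
  have hFm : ∀ n, AEStronglyMeasurable (F n) ν := fun n =>
    AEStronglyMeasurable.mul (by fun_prop) hm
  have hFb : ∀ n t, ‖F n t‖ ≤ bound n t := fun n t => by simp [F, bound]
  have hbs : ∀ t, Summable fun n => bound n t := fun t =>
    (Real.summable_pow_div_factorial _).mul_right _
  have hbi : Integrable (fun t => ∑' n, bound n t) ν := by
    simp_rw [bound, hbound]; exact hexp |ξ|
  have hFs : ∀ t, HasSum (fun n => F n t) (Complex.exp (ξ * t * Complex.I) * h t) :=
    fun t => (hser _).mul_right (h t)
  -- Expanding `exp(iξt)` makes each term a moment of `h`; the partial sums are dominated by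
  -- `exp(|ξ||t|) ‖h‖`.
  have hsum := hasSum_integral_of_dominated_convergence bound hFm
    (fun n => Filter.Eventually.of_forall (hFb n)) (Filter.Eventually.of_forall hbs) hbi
    (Filter.Eventually.of_forall hFs)
  have hzero : ∀ n : ℕ, ∫ t, F n t ∂ν = 0 := fun n => by
    rw [show F n = fun t : ℝ =>
      ((ξ * Complex.I) ^ n / (n.factorial : ℂ)) * ((t : ℂ) ^ n * h t) by funext t; simp only [hF]; ring,
      integral_const_mul, hz, mul_zero]
  rw [funext hzero] at hsum
  exact hsum.unique hasSum_zero

/-! ### Orthonormality and completeness in the weighted space. -/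

lemma measurable_weight (μ : ℝ) : Measurable fun t : ℝ => ENNReal.ofReal (|t| ^ (2 * μ)) := by
  fun_prop

instance (μ : ℝ) : SigmaFinite (weightMeasure μ) :=
  SigmaFinite.withDensity_of_ne_top (Filter.Eventually.of_forall fun _ => ENNReal.ofReal_ne_top)

lemma integrable_weightMeasure_iff {E : Type*} [NormedAddCommGroup E] [NormedSpace ℝ E] (μ : ℝ)
    {g : ℝ → E} :
    Integrable g (weightMeasure μ) ↔ Integrable fun t => |t| ^ (2 * μ) • g t := by
  rw [weightMeasure, integrable_withDensity_iff_integrable_smul' (measurable_weight μ)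
    (Filter.Eventually.of_forall fun _ => ENNReal.ofReal_lt_top)]
  simp only [ENNReal.toReal_ofReal (Real.rpow_nonneg (abs_nonneg _) _)]

lemma integral_weightMeasure {E : Type*} [NormedAddCommGroup E] [NormedSpace ℝ E] (μ : ℝ)
    (g : ℝ → E) :
    ∫ t, g t ∂(weightMeasure μ) = ∫ t, |t| ^ (2 * μ) • g t := by
  rw [weightMeasure, integral_withDensity_eq_integral_toReal_smul (measurable_weight μ)
    (Filter.Eventually.of_forall fun _ => ENNReal.ofReal_lt_top)]
  simp only [ENNReal.toReal_ofReal (Real.rpow_nonneg (abs_nonneg _) _)]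

lemma memLp_exp_mul_exp {μ : ℝ} (hμ : -(1 / 2) < μ) (a : ℝ) :
    MemLp (fun t : ℝ => Real.exp (a * |t|) * Real.exp (-(1 / 2) * t ^ 2)) 2
      (weightMeasure μ) := by
  rw [memLp_two_iff_integrable_sq (by fun_prop), integrable_weightMeasure_iff]
  -- The constant `exp(2a²)` comes from `(2a - |t|)² ≥ 0`, that is, `2a|t| - t² ≤ 2a² - t²/2`.
  refine Integrable.mono' ((integrable_exp_mul_abs_rpow (b := μ + 1 / 2) (s := 1 / 2)
    (by linarith) (by norm_num)).const_mul (Real.exp (2 * a ^ 2))) (by fun_prop)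
    (Filter.Eventually.of_forall fun t => ?_)
  have hw : 2 * (μ + 1 / 2) - 1 = 2 * μ := by ring
  rw [hw, norm_smul, Real.norm_of_nonneg (by positivity), Real.norm_of_nonneg (by positivity),
    mul_comm, ← mul_assoc]
  gcongr
  rw [← Real.exp_add, ← Real.exp_add, ← Real.exp_nat_mul]
  apply Real.exp_le_exp.mpr
  push_cast
  nlinarith [sq_nonneg (2 * a - |t|), sq_abs t]

lemma measurable_confluentPoly (m : ℕ) (c : ℝ) : Measurable (confluentPoly m c) := by
  unfold confluentPoly
  fun_prop

lemma measurable_laguerreFun (c : ℝ) (m : ℕ) : Measurable (laguerreFun c m) := by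
  have := (measurable_confluentPoly m c).comp (by fun_prop : Measurable fun t : ℝ => t ^ 2)
  exact (Measurable.mul (by fun_prop) this).const_mul _

lemma measurable_hermiteFun {μ : ℝ} (hμ : -(1 / 2) < μ) (n : ℕ) :
    Measurable (hermiteFun μ n) := by
  obtain ⟨m, rfl | rfl⟩ := n.even_or_odd'
  · rw [funext (hermiteFun_two_mul hμ m)]; exact measurable_laguerreFun _ _
  · rw [funext (hermiteFun_two_mul_add_one hμ m)]
    exact measurable_id.mul (measurable_laguerreFun _ _)

lemma hermiteFun_neg {μ : ℝ} (hμ : -(1 / 2) < μ) (n : ℕ) (t : ℝ) :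
    hermiteFun μ n (-t) = (-1) ^ n * hermiteFun μ n t := by
  obtain ⟨m, rfl | rfl⟩ := n.even_or_odd'
  · simp [hermiteFun_two_mul hμ, laguerreFun_neg]
  · simp [hermiteFun_two_mul_add_one hμ, laguerreFun_neg, pow_succ]

lemma hermiteFun_mul_two_mul {μ : ℝ} (hμ : -(1 / 2) < μ) (m n : ℕ) (t : ℝ) :
    |t| ^ (2 * μ) * (hermiteFun μ (2 * m) t * hermiteFun μ (2 * n) t) =
      laguerreFun (μ + 1 / 2) m t * laguerreFun (μ + 1 / 2) n t *
        |t| ^ (2 * (μ + 1 / 2) - 1) := by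
  rw [hermiteFun_two_mul hμ, hermiteFun_two_mul hμ, show 2 * (μ + 1 / 2) - 1 = 2 * μ by ring]
  ring

lemma hermiteFun_mul_two_mul_add_one {μ : ℝ} (hμ : -(1 / 2) < μ) (m n : ℕ) (t : ℝ) :
    |t| ^ (2 * μ) * (hermiteFun μ (2 * m + 1) t * hermiteFun μ (2 * n + 1) t) =
      laguerreFun (μ + 3 / 2) m t * laguerreFun (μ + 3 / 2) n t *
        |t| ^ (2 * (μ + 3 / 2) - 1) := by
  have h := sq_mul_abs_rpow (c := μ + 1 / 2) (by linarith) t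
  rw [show μ + 1 / 2 + 1 = μ + 3 / 2 by ring, show 2 * (μ + 1 / 2) - 1 = 2 * μ by ring] at h
  rw [hermiteFun_two_mul_add_one hμ, hermiteFun_two_mul_add_one hμ, ← h]
  ring

lemma integral_hermiteFun_mul_hermiteFun {μ : ℝ} (hμ : -(1 / 2) < μ) (i j : ℕ) :
    ∫ t, hermiteFun μ i t * hermiteFun μ j t ∂(weightMeasure μ) = if i = j then 1 else 0 := by
  rw [integral_weightMeasure]
  simp only [smul_eq_mul]
  obtain ⟨m, rfl | rfl⟩ := i.even_or_odd' <;> obtain ⟨n, rfl | rfl⟩ := j.even_or_odd'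
  · simp_rw [hermiteFun_mul_two_mul hμ]
    rw [integral_laguerreFun_mul_laguerreFun (by linarith)]
    simp
  · rw [if_neg (by omega)]
    refine integral_eq_zero_of_odd fun t => ?_
    rw [hermiteFun_neg hμ, hermiteFun_neg hμ, abs_neg, pow_succ, pow_mul, pow_mul]
    simp
  · rw [if_neg (by omega)]
    refine integral_eq_zero_of_odd fun t => ?_
    rw [hermiteFun_neg hμ, hermiteFun_neg hμ, abs_neg, pow_succ, pow_mul, pow_mul]
    simp
  · simp_rw [hermiteFun_mul_two_mul_add_one hμ]
    rw [integral_laguerreFun_mul_laguerreFun (by linarith)]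
    simp

lemma memLp_hermiteFun {μ : ℝ} (hμ : -(1 / 2) < μ) (n : ℕ) :
    MemLp (fun x : ℝ => (hermiteFun μ n x : ℂ)) 2 (weightMeasure μ) := by
  suffices h : MemLp (hermiteFun μ n) 2 (weightMeasure μ) from h.ofReal
  rw [memLp_two_iff_integrable_sq (measurable_hermiteFun hμ n).aestronglyMeasurable,
    integrable_weightMeasure_iff]
  simp only [smul_eq_mul, sq]
  obtain ⟨m, rfl | rfl⟩ := n.even_or_odd'
  · simp_rw [hermiteFun_mul_two_mul hμ]
    exact integrable_laguerreFun_mul_laguerreFun (by linarith) _ _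
  · simp_rw [hermiteFun_mul_two_mul_add_one hμ]
    exact integrable_laguerreFun_mul_laguerreFun (by linarith) _ _

lemma orthonormal_hermiteFun {μ : ℝ} (hμ : -(1 / 2) < μ) :
    Orthonormal ℂ (fun n : ℕ => (memLp_hermiteFun hμ n).toLp) := by
  rw [orthonormal_iff_ite]
  intro i j
  have h := congrArg (fun r : ℝ => (r : ℂ)) (integral_hermiteFun_mul_hermiteFun hμ i j)
  rw [L2.inner_def]
  have hae : (fun a => inner ℂ ((memLp_hermiteFun hμ i).toLp _ a)
      ((memLp_hermiteFun hμ j).toLp _ a)) =ᵐ[weightMeasure μ]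
      fun t => ((hermiteFun μ i t * hermiteFun μ j t : ℝ) : ℂ) := by
    filter_upwards [(memLp_hermiteFun hμ i).coeFn_toLp, (memLp_hermiteFun hμ j).coeFn_toLp]
      with t h1 h2
    rw [h1, h2]
    simp [mul_comm]
  rw [integral_congr_ae hae, integral_complex_ofReal, h]
  split_ifs <;> simp

/-- Binomial inversion: at ratio `-1` the transform of the confluent polynomials collapses to its
top power. -/
lemma sq_pow_mul_exp_eq_sum_laguerreFun {c : ℝ} (hc : 0 < c) (m : ℕ) :
    ∃ b : ℕ → ℝ, ∀ t : ℝ, (t ^ 2) ^ m * Real.exp (-(1 / 2) * t ^ 2) =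
      ∑ i ∈ Finset.range (m + 1), b i * laguerreFun c i t := by
  refine ⟨fun i => poch c m * ((m.choose i : ℝ) * (-1) ^ i) /
    ((-1) ^ i * √(poch c i / (i.factorial * Real.Gamma c))), fun t => ?_⟩
  have h := sum_choose_mul_pow_mul_confluentPoly hc m (-1) (t ^ 2)
  have hr : ∑ l ∈ Finset.range (m + 1), (m.choose l : ℝ) * (-1) ^ l * (1 + -1) ^ (m - l) *
      ((-t ^ 2) ^ l / poch c l) = (-1) ^ m * ((-t ^ 2) ^ m / poch c m) := by
    rw [Finset.sum_eq_single m]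
    · simp
    · intro l hl hlm
      have := Finset.mem_range.mp hl
      rw [show (1 + -1 : ℝ) = 0 by ring, zero_pow (by omega)]
      simp
    · intro hm
      simp at hm
  have h1 : ((-1 : ℝ) ^ m) * (-t ^ 2) ^ m = (t ^ 2) ^ m := by rw [← mul_pow]; simp
  have hp := poch_ne_zero hc m
  have h2 : (t ^ 2) ^ m = poch c m * ∑ i ∈ Finset.range (m + 1),
      (m.choose i : ℝ) * (-1) ^ i * confluentPoly i c (t ^ 2) := by
    rw [h, hr, ← h1]
    field_simp
  rw [h2, Finset.mul_sum, Finset.sum_mul]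
  refine Finset.sum_congr rfl fun i _ => ?_
  have hS : √(poch c i / (i.factorial * Real.Gamma c)) ≠ 0 := by
    have := poch_pos hc i
    have := Real.Gamma_pos_of_pos hc
    positivity
  rw [laguerreFun]
  beta_reduce
  generalize √(poch c i / (i.factorial * Real.Gamma c)) = S at *
  have h3 : ((-1 : ℝ) ^ i) ≠ 0 := pow_ne_zero _ (by norm_num)
  generalize (-1 : ℝ) ^ i = e at *
  field_simp

lemma pow_mul_exp_eq_sum_hermiteFun {μ : ℝ} (hμ : -(1 / 2) < μ) (n : ℕ) :
    ∃ (m : ℕ) (b : ℕ → ℝ) (k : ℕ → ℕ), ∀ t : ℝ, t ^ n * Real.exp (-(1 / 2) * t ^ 2) =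
      ∑ i ∈ Finset.range (m + 1), b i * hermiteFun μ (k i) t := by
  obtain ⟨m, rfl | rfl⟩ := n.even_or_odd'
  · obtain ⟨b, hb⟩ := sq_pow_mul_exp_eq_sum_laguerreFun (c := μ + 1 / 2) (by linarith) m
    refine ⟨m, b, fun i => 2 * i, fun t => ?_⟩
    simp only [hermiteFun_two_mul hμ]
    rw [pow_mul, hb]
  · obtain ⟨b, hb⟩ := sq_pow_mul_exp_eq_sum_laguerreFun (c := μ + 3 / 2) (by linarith) m
    refine ⟨m, b, fun i => 2 * i + 1, fun t => ?_⟩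
    simp only [hermiteFun_two_mul_add_one hμ]
    rw [pow_succ', mul_assoc, pow_mul, hb, Finset.mul_sum]
    exact Finset.sum_congr rfl fun i _ => by ring

lemma topologicalClosure_span_hermiteFun {μ : ℝ} (hμ : -(1 / 2) < μ) :
    (Submodule.span ℂ (Set.range fun n : ℕ =>
      (memLp_hermiteFun hμ n).toLp)).topologicalClosure = ⊤ := by
  rw [Submodule.topologicalClosure_eq_top_iff, Submodule.eq_bot_iff]
  intro f hf
  have hfm := Lp.memLp f
  have hint : ∀ n, Integrable (fun t => (hermiteFun μ n t : ℂ) * f t) (weightMeasure μ) :=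
    fun n => (memLp_hermiteFun hμ n).integrable_mul hfm
  have hz : ∀ n, ∫ t, (hermiteFun μ n t : ℂ) * f t ∂(weightMeasure μ) = 0 := fun n => by
    have h := (Submodule.mem_orthogonal _ f).mp hf _ (Submodule.subset_span ⟨n, rfl⟩)
    rw [L2.inner_def] at h
    rw [← h]
    refine integral_congr_ae ?_
    filter_upwards [(memLp_hermiteFun hμ n).coeFn_toLp] with t ht
    rw [ht]
    simp [mul_comm]
  have hzero := ae_eq_zero_of_moments_eq_zero (ν := weightMeasure μ)
    (h := fun t => (Real.exp (-(1 / 2) * t ^ 2) : ℂ) * f t)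
    (AEStronglyMeasurable.mul (by fun_prop) hfm.1)
    -- Exponential decay by Hölder: `exp(a|t|) exp(-t²/2)` and `f` are both in `L²`, so their
    -- product is integrable.
    (fun a => by
      refine ((memLp_exp_mul_exp hμ a).integrable_mul hfm.norm).congr
        (Filter.Eventually.of_forall fun t => ?_)
      simp only [Pi.mul_apply]
      rw [norm_mul, Complex.norm_real, Real.norm_of_nonneg (Real.exp_pos _).le, mul_assoc])
    (fun n => by
      obtain ⟨m, b, k, h⟩ := pow_mul_exp_eq_sum_hermiteFun hμ n
      have heq : ∀ t : ℝ, (t : ℂ) ^ n * ((Real.exp (-(1 / 2) * t ^ 2) : ℂ) * f t) =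
          ∑ i ∈ Finset.range (m + 1), (b i : ℂ) * ((hermiteFun μ (k i) t : ℂ) * f t) :=
        fun t => by
        have ht := congrArg (fun r : ℝ => (r : ℂ) * f t) (h t)
        simp only [Complex.ofReal_sum, Complex.ofReal_mul, Complex.ofReal_pow] at ht
        rw [← mul_assoc, ht, Finset.sum_mul]
        exact Finset.sum_congr rfl fun i _ => by ring
      simp_rw [heq]
      rw [integral_finsetSum _ fun i _ => (hint (k i)).const_mul _]
      simp_rw [integral_const_mul, hz, mul_zero, Finset.sum_const_zero])
  rw [Lp.eq_zero_iff_ae_eq_zero]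
  filter_upwards [hzero] with t ht
  have he : ((Real.exp (-(1 / 2) * t ^ 2) : ℝ) : ℂ) ≠ 0 := by
    exact_mod_cast (Real.exp_pos _).ne'
  exact (mul_eq_zero.mp ht).resolve_left he

end GenHermite

end

theorem mainTheorem5 (μ : ℝ) (hμ : -(1 / 2) < μ) :
    -- the generalized Hermite functions form a complete orthonormal set in `L²_μ(ℝ)`
    (∃ hL2 : ∀ n : ℕ,
        MemLp (fun x : ℝ => (GenHermite.hermiteFun μ n x : ℂ)) 2 (GenHermite.weightMeasure μ),
      Orthonormal ℂ (fun n : ℕ => (hL2 n).toLp) ∧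
      (Submodule.span ℂ (Set.range fun n : ℕ => (hL2 n).toLp)).topologicalClosure = ⊤) ∧
    -- they lie in the domain of the generalized Fourier transform and are eigenfunctions of it
    (∀ n : ℕ,
      (fun x : ℝ => (GenHermite.hermiteFun μ n x : ℂ)) ∈ GenHermite.fourierDomain ∧
      ∀ x : ℝ,
        Integrable
          (GenHermite.fourierIntegrand μ (fun t : ℝ => (GenHermite.hermiteFun μ n t : ℂ)) x) ∧
        GenHermite.fourierMu μ (fun t : ℝ => (GenHermite.hermiteFun μ n t : ℂ)) x =
          (-Complex.I) ^ n * (GenHermite.hermiteFun μ n x : ℂ)) ∧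
    -- Mehler formula
    (∀ (x y : ℝ) (z : ℂ), ‖z‖ < 1 →
      HasSum
        (fun n : ℕ =>
          (GenHermite.hermiteFun μ n x : ℂ) * (GenHermite.hermiteFun μ n y : ℂ) * z ^ n)
        (1 / (Real.Gamma (μ + 1 / 2) : ℂ) *
          (1 / (1 - z ^ 2) ^ ((μ : ℂ) + 1 / 2)) *
          Complex.exp (-(1 / 2) * ((x : ℂ) ^ 2 + (y : ℂ) ^ 2) * ((1 + z ^ 2) / (1 - z ^ 2))) *
          GenHermite.expMu μ (2 * (x : ℂ) * (y : ℂ) * (z / (1 - z ^ 2))))) := by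
  exact ⟨⟨GenHermite.memLp_hermiteFun hμ, GenHermite.orthonormal_hermiteFun hμ,
      GenHermite.topologicalClosure_span_hermiteFun hμ⟩,
    fun n => ⟨GenHermite.hermiteFun_mem_fourierDomain hμ n,
      GenHermite.fourierMu_hermiteFun hμ n⟩,
    fun x y _ hz => GenHermite.hasSum_hermiteFun_mul hμ x y hz⟩
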